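/- Let $n\ge 2$ and $\lambda>0$. For a smooth immersed hypersurface $X:M^n\to\mathbb R^{n+1}$ with smooth unit normal field $N$, let $H$ be its mean curvature with respect to $N$, i.e. the trace of the shape operator $A$ defined by $dN=-dX\circ A$ (so the sphere of radius $a$ has $H=n/a$ with respect to its inward normal); $X$ is called a $\lambda$-hypersurface if $\langle X,N\rangle+H=\lambda$ on $M$. Theorem 1.1. For every $n\ge 2$ and every $\lambda>0$ there exists a compact embedded rotational $\lambda$-hypersurface $X:S^1\times S^{n-1}\to\mathbb R^{n+1}$ (called a $\lambda$-torus). More precisely, there are $\ell>0$ and smooth $2\ell$-periodic functions $x,r:\mathbb R\to\mathbb R$ with $(x')^2+(r')^2=1$ and $r>0$ such that $s\mapsto(x(s),r(s))$ is a simple closed curve in the upper half plane $\{r>0\}$ (injective on $[0,2\ell)$), symmetric under reflection in the $r$-axis ($x(-s)=-x(s)$, $r(-s)=r(s)$), whose half $0\le s\le \ell$ is an arc with $x>0$ for $0<s<\ell$, $x(0)=x(\ell)=0$, $r(0)<r(\ell)$ and horizontal tangents $(x',r')(0)=(1,0)$, $(x',r')(\ell)=(-1,0)$, and such that $$X(e^{i\pi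 s/\ell},\alpha)=(x(s),\,r(s)\alpha),\qquad s\in\mathbb R,\ \alpha\in S^{n-1}\subset\mathbb R^n,$$ is a smooth embedding and a $\lambda$-hypersurface with respect to the unit normal $N(e^{i\pi s/\ell},\alpha)=(-r'(s),\,x'(s)\alpha)$. -/

import Mathlib

open scoped Manifold ContDiff InnerProductSpace

section Hypersurface

variable {n : ℕ} {E H M : Type*} [NormedAddCommGroup E] [NormedSpace ℝ E] [TopologicalSpace H]
  [TopologicalSpace M] [ChartedSpace H M]

/-- `A` is the shape operator (Weingarten map) at `p` of the immersion `X` with respect to the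
unit normal field `N`: it is the endomorphism of the tangent space with `dN = - dX ∘ A`. -/
def IsShapeOperatorAt (I : ModelWithCorners ℝ E H) (X N : M → EuclideanSpace ℝ (Fin (n + 1)))
    (p : M) (A : TangentSpace I p →ₗ[ℝ] TangentSpace I p) : Prop :=
  ∀ v : TangentSpace I p, mvfderiv I N p v = -mvfderiv I X p (A v)

/-- `h` is the mean curvature at `p` of the immersion `X` with respect to the unit normal field
`N`: the trace of the shape operator, that is, the sum of the principal curvatures (not
normalized). The mean curvature vector is `h • N p`, and the sphere of radius `a` has mean
curvature `n / a` with respect to its inward normal. -/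
def HasMeanCurvatureAt (I : ModelWithCorners ℝ E H) (X N : M → EuclideanSpace ℝ (Fin (n + 1)))
    (p : M) (h : ℝ) : Prop :=
  ∃ A : TangentSpace I p →ₗ[ℝ] TangentSpace I p,
    IsShapeOperatorAt I X N p A ∧ LinearMap.trace ℝ (TangentSpace I p) A = h

/-- `X : M → ℝⁿ⁺¹` is a smooth immersed hypersurface (`M` being a smooth `n`-manifold) and `N` is
a smooth unit normal field along `X`. -/
structure IsImmersedHypersurface (I : ModelWithCorners ℝ E H) [IsManifold I ∞ M]
    (X N : M → EuclideanSpace ℝ (Fin (n + 1))) : Prop where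
  dim_eq : Module.finrank ℝ E = n
  smooth : ContMDiff I 𝓘(ℝ, EuclideanSpace ℝ (Fin (n + 1))) ∞ X
  immersive : ∀ p : M, Function.Injective (mvfderiv I X p)
  smooth_normal : ContMDiff I 𝓘(ℝ, EuclideanSpace ℝ (Fin (n + 1))) ∞ N
  norm_normal : ∀ p : M, ‖N p‖ = 1
  normal_orthogonal : ∀ (p : M) (v : TangentSpace I p), ⟪mvfderiv I X p v, N p⟫_ℝ = 0

/-- `X`, with unit normal field `N`, is a `lam`-hypersurface: an immersed hypersurface whose mean
curvature `h` satisfies `⟨X, N⟩ + h = lam` at every point. -/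
structure IsLambdaHypersurface (I : ModelWithCorners ℝ E H) [IsManifold I ∞ M]
    (X N : M → EuclideanSpace ℝ (Fin (n + 1))) (lam : ℝ) : Prop
    extends IsImmersedHypersurface I X N where
  equation : ∀ p : M, ∃ h : ℝ, HasMeanCurvatureAt I X N p h ∧ ⟪X p, N p⟫_ℝ + h = lam

end Hypersurface

/-- The unit sphere `Sⁿ⁻¹` in `ℝⁿ`. -/
abbrev UnitSphere (n : ℕ) : Type := Metric.sphere (0 : EuclideanSpace ℝ (Fin n)) 1

theorem fact_finrank_euclideanSpace {n : ℕ} (hn : 2 ≤ n) :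
    Fact (Module.finrank ℝ (EuclideanSpace ℝ (Fin n)) = n - 1 + 1) :=
  ⟨by rw [finrank_euclideanSpace_fin]; omega⟩

/-- The point `(a, ρ α)` of `ℝⁿ⁺¹ = ℝ × ℝⁿ`. -/
noncomputable def revolve {n : ℕ} (a ρ : ℝ) (α : UnitSphere n) : EuclideanSpace ℝ (Fin (n + 1)) :=
  WithLp.toLp 2 (Fin.cons a fun i => ρ * (α : EuclideanSpace ℝ (Fin n)) i)

/-- `s ↦ (x s, r s)` is a smooth simple closed curve of length `2 * l` in the upper half plane
`{r > 0}`, parametrized by arc length and symmetric under reflection in the `r`-axis `{x = 0}`.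
Its half `0 ≤ s ≤ l` runs, inside the open first quadrant for `0 < s < l`, from the lower to the
upper of two points of the `r`-axis, with horizontal tangents `(1, 0)` and `(-1, 0)` there. -/
structure IsTorusProfile (x r : ℝ → ℝ) (l : ℝ) : Prop where
  pos_length : 0 < l
  smooth_x : ContDiff ℝ ∞ x
  smooth_r : ContDiff ℝ ∞ r
  arc_length : ∀ s, deriv x s ^ 2 + deriv r s ^ 2 = 1
  upper_half_plane : ∀ s, 0 < r s
  periodic_x : Function.Periodic x (2 * l)
  periodic_r : Function.Periodic r (2 * l)
  simple : Set.InjOn (fun s => (x s, r s)) (Set.Ico 0 (2 * l))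
  reflect_x : ∀ s, x (-s) = -x s
  reflect_r : ∀ s, r (-s) = r s
  start_on_axis : x 0 = 0
  end_on_axis : x l = 0
  first_quadrant : ∀ s ∈ Set.Ioo 0 l, 0 < x s
  start_below_end : r 0 < r l
  start_horizontal : deriv x 0 = 1 ∧ deriv r 0 = 0
  end_horizontal : deriv x l = -1 ∧ deriv r l = 0

/-! ### Global flows of bounded Lipschitz vector fields and their dependence on initial data. -/

section Flow

open Metric Set Filter Topology

variable {E : Type*} [NormedAddCommGroup E] [NormedSpace ℝ E]

/-! Put `m = n - 1` and let `θ` be the tangent angle of an arc-length profile `(x, r)`. Rotating it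
gives a `lam`-hypersurface as soon as `x' = cos θ`, `r' = sin θ` and `θ' = lam + x sin θ + (m / r -
r) cos θ`. This system is invariant under reflection in the `r`-axis combined with reversal of time.
So an arc that leaves the axis horizontally at `(0, δ)` and meets it again with `θ = π` doubles to a
smooth closed curve (`reflect_eq_self`), and the problem is to find such a `δ` by shooting.

For some small `δ` the term `m / r` turns the tangent past the vertical almost at once, and the
curve crosses the axis while `θ < π` (`exists_small_height`). A curve that crosses the axis in this
way has `δ ≤ lam + m + 1`, and its time of return is bounded in terms of `m` and `lam`
(`IsShot.duration_le`, `exists_isWeakReturn`). Hence the pairs (height, return time) satisfying the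
closed conditions `IsWeakReturn` can be confined to a compact set (`isCompact_isWeakReturn`), and
one of them has largest height.

For that extremal shot the closed conditions improve to strict ones (`IsWeakReturn.exists_isTurn`):
a degenerate contact would make the curve a horizontal line, or give the curvature an interior
minimum with nonzero derivative. If its final angle were less than `π`, it would cross the axis
transversally, and so would some slightly higher shots (`exists_higher_return`), against maximality.
So the final angle is `π`.

On the arc `r` is strictly increasing and `x` is positive in the interior, which makes the doubled
curve simple. The principal curvatures of the rotated hypersurface are `θ'`, once, and `-cos θ / r`,
`n - 1` times; with the support function `r cos θ - x sin θ` they add up to `lam`. -/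

theorem solution_unique {V : E → E} {K : NNReal} (hV : LipschitzWith K V) {f g : ℝ → E}
    (hf : ∀ t, HasDerivAt f (V (f t)) t) (hg : ∀ t, HasDerivAt g (V (g t)) t) {t₀ : ℝ}
    (h : f t₀ = g t₀) : f = g :=
  ODE_solution_unique_univ (v := fun _ => V) (s := fun _ => univ) (K := K)
    (fun _ => hV.lipschitzOnWith) (fun t => ⟨hf t, trivial⟩) (fun t => ⟨hg t, trivial⟩) h

theorem exists_solution_Icc [CompleteSpace E] {V : E → E} {K L : NNReal} (hV : LipschitzWith K V)
    (hL : ∀ p, ‖V p‖ ≤ L) (p : E) (n : ℕ) :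
    ∃ f : ℝ → E, f 0 = p ∧ ∀ t ∈ Ioo (-(n : ℝ)) n, HasDerivAt f (V (f t)) t := by
  have h0 : (0 : ℝ) ∈ Icc (-(n : ℝ)) n := by simp
  have : IsPicardLindelof (fun _ => V) (⟨0, h0⟩ : Icc (-(n : ℝ)) n) p (L * n) 0 L K :=
    IsPicardLindelof.of_time_independent (fun x _ => hL x) hV.lipschitzOnWith (by simp)
  obtain ⟨f, hf0, hf⟩ := this.exists_eq_forall_mem_Icc_hasDerivWithinAt₀
  exact ⟨f, hf0, fun t ht => (hf t (Ioo_subset_Icc_self ht)).hasDerivAt (Icc_mem_nhds ht.1 ht.2)⟩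

/-- Boundedness lets Picard–Lindelöf run on each `[-n, n]`, in a ball of radius `L * n`. By
uniqueness the local solutions agree on overlaps, so at time `t` any one with `|t| < n` may be used.
-/
theorem exists_solution [CompleteSpace E] {V : E → E} {K L : NNReal} (hV : LipschitzWith K V)
    (hL : ∀ p, ‖V p‖ ≤ L) (p : E) :
    ∃ f : ℝ → E, f 0 = p ∧ ∀ t, HasDerivAt f (V (f t)) t := by
  choose f hf0 hf using exists_solution_Icc hV hL p
  have agree : ∀ m n : ℕ, m ≤ n → ∀ t ∈ Ioo (-(m : ℝ)) m, f m t = f n t := by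
    intro m n hmn t ht
    have hmn' : (m : ℝ) ≤ n := by exact_mod_cast hmn
    have hm : (0 : ℝ) < m := by linarith [ht.1, ht.2]
    refine ODE_solution_unique_of_mem_Ioo (v := fun _ => V) (s := fun _ => univ) (K := K)
      (t₀ := 0) (a := -(m : ℝ)) (b := m) (fun _ _ => hV.lipschitzOnWith) ⟨by linarith, hm⟩
      (fun t ht => ⟨hf m t ht, trivial⟩)
      (fun t ht => ⟨hf n t ⟨by linarith [ht.1], by linarith [ht.2]⟩, trivial⟩)
      (by rw [hf0, hf0]) ht
  have hN : ∀ t : ℝ, ∃ n : ℕ, |t| < n := fun t => exists_nat_gt _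
  choose N hN using hN
  refine ⟨fun t => f (N t) t, hf0 _, fun t => ?_⟩
  refine (hf (N t) t (abs_lt.1 (hN t))).congr_of_eventuallyEq ?_
  filter_upwards [isOpen_Ioo.mem_nhds (abs_lt.1 (hN t))] with u hu
  rcases le_total (N t) (N u) with h | h
  · exact (agree _ _ h u hu).symm
  · exact agree _ _ h u (abs_lt.1 (hN u))

theorem dist_solution_le {V : E → E} {K : NNReal} (hV : LipschitzWith K V) {f g : ℝ → E}
    (hf : ∀ t, HasDerivAt f (V (f t)) t) (hg : ∀ t, HasDerivAt g (V (g t)) t) {t : ℝ}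
    (ht : 0 ≤ t) : dist (f t) (g t) ≤ dist (f 0) (g 0) * Real.exp (K * t) := by
  have := dist_le_of_trajectories_ODE (v := fun _ => V) (K := K) (a := 0) (b := t)
    (fun _ => hV) (fun s _ => (hf s).continuousAt.continuousWithinAt)
    (fun s _ => (hf s).hasDerivWithinAt) (fun s _ => (hg s).continuousAt.continuousWithinAt)
    (fun s _ => (hg s).hasDerivWithinAt) le_rfl t ⟨ht, le_rfl⟩
  simpa using this

/-- Grönwall's inequality bounds the distance to the trajectory through the base point, locally
uniformly in time. It is used for forward time only, which is why later maps replace a time by its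
maximum with `0`. -/
theorem continuousOn_solution {V : E → E} {K : NNReal} (hV : LipschitzWith K V)
    {Z : Type*} [TopologicalSpace Z] {γ : Z → ℝ → E} (h0 : Continuous fun z => γ z 0)
    (hγ : ∀ z t, HasDerivAt (γ z) (V (γ z t)) t) :
    ContinuousOn (fun q : Z × ℝ => γ q.1 q.2) {q | 0 ≤ q.2} := by
  rintro ⟨z, t⟩ ht
  have h1 : Tendsto (fun q : Z × ℝ => γ z q.2) (𝓝[{q | 0 ≤ q.2}] (z, t)) (𝓝 (γ z t)) :=
    ((hγ z t).continuousAt.comp (f := Prod.snd) continuousAt_snd).continuousWithinAt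
  refine tendsto_of_tendsto_of_dist h1 ?_
  refine squeeze_zero' (g := fun q : Z × ℝ => dist (γ z 0) (γ q.1 0) * Real.exp (K * q.2))
    (Eventually.of_forall fun _ => dist_nonneg) ?_ ?_
  · filter_upwards [self_mem_nhdsWithin] with q hq
    exact dist_solution_le hV (hγ z) (hγ q.1) hq
  · have : Continuous fun q : Z × ℝ => dist (γ z 0) (γ q.1 0) * Real.exp (K * q.2) := by
      fun_prop
    simpa using (this.tendsto (z, t)).mono_left nhdsWithin_le_nhds

end Flow

/-! ### The truncated profile vector field. -/

section Field

/-- The truncation of a real number to the interval `[-K, K]`. -/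
noncomputable def clip (K x : ℝ) : ℝ := max (-K) (min K x)

theorem clip_eq_self {K x : ℝ} (h : |x| ≤ K) : clip K x = x := by
  rw [abs_le] at h
  rw [clip, min_eq_right h.2, max_eq_right h.1]

theorem clip_neg {K : ℝ} (hK : 0 ≤ K) (x : ℝ) : clip K (-x) = -clip K x := by
  unfold clip
  rcases le_total K x with h | h <;> rcases le_total K (-x) with h' | h' <;>
    rcases le_total (-K) x with h1 | h1 <;> rcases le_total (-K) (-x) with h2 | h2 <;>
    simp [min_def, max_def] <;> split_ifs <;> linarith

theorem abs_clip_le {K : ℝ} (hK : 0 ≤ K) (x : ℝ) : |clip K x| ≤ K :=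
  abs_le.2 ⟨le_max_left _ _, max_le (by linarith) (min_le_left _ _)⟩

theorem lipschitzWith_clip (K : ℝ) : LipschitzWith 1 (clip K) :=
  (LipschitzWith.id.const_min K).const_max (-K)

/-- The vector field on `{(x, r, θ)}` whose integral curves are the profile curves parametrized by
arc length, made bounded and Lipschitz by truncation outside `{|x| ≤ K, d ≤ r ≤ K}`. -/
noncomputable def profileField (m : ℕ) (lam d K : ℝ) (p : ℝ × ℝ × ℝ) : ℝ × ℝ × ℝ :=
  (Real.cos p.2.2, Real.sin p.2.2,
    lam + clip K p.1 * Real.sin p.2.2 + (m / max p.2.1 d - clip K p.2.1) * Real.cos p.2.2)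

theorem lipschitzWith_mul_of_bounded {α : Type*} [PseudoMetricSpace α] {f g : α → ℝ}
    {Kf Kg Bf Bg : NNReal} (hf : LipschitzWith Kf f) (hg : LipschitzWith Kg g)
    (hBf : ∀ a, |f a| ≤ Bf) (hBg : ∀ a, |g a| ≤ Bg) :
    LipschitzWith (Bf * Kg + Kf * Bg) (fun a => f a * g a) := by
  refine LipschitzWith.of_dist_le_mul fun a b => ?_
  have h1 := hf.dist_le_mul a b
  have h2 := hg.dist_le_mul a b
  rw [Real.dist_eq] at *
  have e : f a * g a - f b * g b = f a * (g a - g b) + (f a - f b) * g b := by ring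
  calc |f a * g a - f b * g b| ≤ |f a| * |g a - g b| + |f a - f b| * |g b| := by
        rw [e, ← abs_mul, ← abs_mul]; exact abs_add_le _ _
    _ ≤ Bf * (Kg * dist a b) + (Kf * dist a b) * Bg := by
        gcongr
        · exact hBf a
        · exact hBg b
    _ = _ := by push_cast; ring

theorem abs_div_max_le {d : ℝ} (hd : 0 < d) (m : ℕ) (r : ℝ) : |(m : ℝ) / max r d| ≤ m / d := by
  have h : d ≤ max r d := le_max_right _ _
  have h0 : 0 < max r d := hd.trans_le h
  rw [abs_of_nonneg (by positivity)]
  gcongr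

theorem lipschitzWith_div_max {d : ℝ} (hd : 0 < d) (m : ℕ) :
    LipschitzWith (Real.toNNReal (m / d ^ 2)) fun r : ℝ => (m : ℝ) / max r d := by
  refine LipschitzWith.of_dist_le_mul fun a b => ?_
  rw [Real.coe_toNNReal _ (by positivity), Real.dist_eq, Real.dist_eq]
  have ha : d ≤ max a d := le_max_right _ _
  have hb : d ≤ max b d := le_max_right _ _
  have ha0 : 0 < max a d := hd.trans_le ha
  have hb0 : 0 < max b d := hd.trans_le hb
  have e : (m : ℝ) / max a d - m / max b d = m / (max a d * max b d) * (max b d - max a d) := by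
    field_simp
  have h1 : |max b d - max a d| ≤ |a - b| := by
    rw [abs_sub_comm a b]; exact abs_max_sub_max_le_abs b a d
  rw [e, abs_mul, abs_of_nonneg (by positivity)]
  gcongr
  nlinarith

theorem exists_lipschitzWith_profileField (m : ℕ) (lam : ℝ) {d K : ℝ} (hd : 0 < d) (hK : 0 ≤ K) :
    ∃ C L : NNReal, LipschitzWith C (profileField m lam d K) ∧
      ∀ p, ‖profileField m lam d K p‖ ≤ L := by
  have hsin : LipschitzWith 1 fun p : ℝ × ℝ × ℝ => Real.sin p.2.2 := by
    simpa [Function.comp_def] using Real.lipschitzWith_sin.comp (LipschitzWith.prod_snd.comp LipschitzWith.prod_snd)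
  have hcos : LipschitzWith 1 fun p : ℝ × ℝ × ℝ => Real.cos p.2.2 := by
    simpa [Function.comp_def] using Real.lipschitzWith_cos.comp (LipschitzWith.prod_snd.comp LipschitzWith.prod_snd)
  have hx : LipschitzWith 1 fun p : ℝ × ℝ × ℝ => clip K p.1 := by
    simpa [Function.comp_def] using (lipschitzWith_clip K).comp LipschitzWith.prod_fst
  have hr : LipschitzWith 1 fun p : ℝ × ℝ × ℝ => clip K p.2.1 := by
    simpa [Function.comp_def] using (lipschitzWith_clip K).comp (LipschitzWith.prod_fst.comp LipschitzWith.prod_snd)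
  have hq : LipschitzWith (Real.toNNReal (m / d ^ 2))
      fun p : ℝ × ℝ × ℝ => (m : ℝ) / max p.2.1 d := by
    simpa [Function.comp_def] using (lipschitzWith_div_max hd m).comp
      (LipschitzWith.prod_fst.comp LipschitzWith.prod_snd)
  lift K to NNReal using hK
  have hmd : (0 : ℝ) ≤ m / d := by positivity
  obtain ⟨B, hB⟩ : ∃ B : NNReal, (B : ℝ) = m / d := ⟨⟨_, hmd⟩, rfl⟩
  have bx : ∀ p : ℝ × ℝ × ℝ, |clip K p.1| ≤ K := fun p => abs_clip_le K.2 _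
  have br : ∀ p : ℝ × ℝ × ℝ, |(m : ℝ) / max p.2.1 d - clip K p.2.1| ≤ (B + K : NNReal) :=
    fun p => (abs_sub _ _).trans (by
      push_cast; rw [hB]; exact add_le_add (abs_div_max_le hd m _) (abs_clip_le K.2 _))
  have bs : ∀ p : ℝ × ℝ × ℝ, |Real.sin p.2.2| ≤ (1 : NNReal) :=
    fun p => by simpa using Real.abs_sin_le_one _
  have bc : ∀ p : ℝ × ℝ × ℝ, |Real.cos p.2.2| ≤ (1 : NNReal) :=
    fun p => by simpa using Real.abs_cos_le_one _
  have l3 := ((LipschitzWith.const lam).add (lipschitzWith_mul_of_bounded hx hsin bx bs)).add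
    (lipschitzWith_mul_of_bounded (hq.sub hr) hcos br bc)
  refine ⟨_, 1 + (Real.nnabs lam + K + (B + K)), hcos.prodMk (hsin.prodMk l3), fun p => ?_⟩
  have h3 : |lam + clip K p.1 * Real.sin p.2.2
      + (m / max p.2.1 d - clip K p.2.1) * Real.cos p.2.2| ≤ |lam| + K + (B + K) := by
    refine (abs_add_le _ _).trans (add_le_add ((abs_add_le _ _).trans (add_le_add le_rfl ?_)) ?_)
    · rw [abs_mul]
      simpa using mul_le_mul (bx p) (bs p) (abs_nonneg _) K.2
    · rw [abs_mul]
      simpa using mul_le_mul (br p) (bc p) (abs_nonneg _) (B + K).2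
  have hKB : (0 : ℝ) ≤ |lam| + K + (B + K) := by positivity
  simp only [profileField, Prod.norm_mk, Real.norm_eq_abs, NNReal.coe_add, NNReal.coe_one,
    Real.coe_nnabs]
  refine max_le ?_ (max_le ?_ ?_)
  · linarith [Real.abs_cos_le_one p.2.2]
  · linarith [Real.abs_sin_le_one p.2.2]
  · linarith

end Field

/-! ### Mean value inequalities, barriers and first hitting times. -/

section Calculus

open Set

variable {f g f' g' : ℝ → ℝ} {a b c : ℝ}

theorem sub_le_sub_of_deriv_le (hab : a ≤ b) (hf : ∀ t ∈ Icc a b, HasDerivAt f (f' t) t)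
    (hg : ∀ t ∈ Icc a b, HasDerivAt g (g' t) t) (h : ∀ t ∈ Icc a b, f' t ≤ g' t) :
    f b - f a ≤ g b - g a := by
  have hd : ∀ t ∈ Icc a b, HasDerivAt (fun t => g t - f t) (g' t - f' t) t :=
    fun t ht => (hg t ht).sub (hf t ht)
  have : MonotoneOn (fun t => g t - f t) (Icc a b) :=
    monotoneOn_of_hasDerivWithinAt_nonneg (convex_Icc a b)
      (fun t ht => (hd t ht).continuousAt.continuousWithinAt)
      (fun t ht => (hd t (interior_subset ht)).hasDerivWithinAt)
      (fun t ht => sub_nonneg.2 (h t (interior_subset ht)))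
  have := this (left_mem_Icc.2 hab) (right_mem_Icc.2 hab) hab
  simp only at this
  linarith

theorem sub_le_mul_of_deriv_le (hab : a ≤ b) (hf : ∀ t ∈ Icc a b, HasDerivAt f (f' t) t)
    (h : ∀ t ∈ Icc a b, f' t ≤ c) : f b - f a ≤ c * (b - a) := by
  have := sub_le_sub_of_deriv_le (g := fun t => c * t) (g' := fun _ => c) hab hf
    (fun t _ => by simpa using (hasDerivAt_id t).const_mul c) h
  linarith

theorem mul_le_sub_of_le_deriv (hab : a ≤ b) (hf : ∀ t ∈ Icc a b, HasDerivAt f (f' t) t)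
    (h : ∀ t ∈ Icc a b, c ≤ f' t) : c * (b - a) ≤ f b - f a := by
  have := sub_le_sub_of_deriv_le (f := fun t => c * t) (f' := fun _ => c) hab
    (fun t _ => by simpa using (hasDerivAt_id t).const_mul c) hf h
  linarith

theorem lt_of_deriv_pos (hab : a < b) (hf : ∀ t ∈ Icc a b, HasDerivAt f (f' t) t)
    (h : ∀ t ∈ Ioo a b, 0 < f' t) : f a < f b :=
  strictMonoOn_of_hasDerivWithinAt_pos (convex_Icc a b)
    (fun t ht => (hf t ht).continuousAt.continuousWithinAt)
    (fun t ht => (hf t (interior_subset ht)).hasDerivWithinAt)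
    (fun t ht => h t (by rwa [interior_Icc] at ht))
    (left_mem_Icc.2 hab.le) (right_mem_Icc.2 hab.le) hab

/-- A barrier: the level `c` can be crossed upwards only. The fencing theorem gives `c ≤ f`; a later
contact with `c` would have positive slope and put `f` below `c` just before. -/
theorem lt_of_deriv_pos_of_eq (hf : ∀ t ∈ Icc a b, HasDerivAt f (f' t) t) (ha : c ≤ f a)
    (h : ∀ t ∈ Icc a b, f t = c → 0 < f' t) {t : ℝ} (ht : t ∈ Ioc a b) : c < f t := by
  have hle : ∀ ⦃u⦄, u ∈ Icc a b → c ≤ f u :=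
    image_le_of_liminf_slope_right_lt_deriv_boundary' (f := fun _ => c) (f' := fun _ => 0)
      continuousOn_const
      (fun u _ r hr => ((hasDerivWithinAt_const u (Ici u) c).liminf_right_slope_le hr)) ha
      (fun u hu => (hf u hu).continuousAt.continuousWithinAt)
      (fun u hu => (hf u (Ico_subset_Icc_self hu)).hasDerivWithinAt)
      (fun u hu hc => h u (Ico_subset_Icc_self hu) hc.symm)
  have htI := Ioc_subset_Icc_self ht
  refine lt_of_le_of_ne (hle htI) fun hc => ?_
  have hpos := h t htI hc.symm
  have : ∀ᶠ u in nhdsWithin t (Iio t), f u < f t := by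
    have := (hasDerivAt_iff_tendsto_slope.1 (hf t htI)).eventually (lt_mem_nhds hpos)
    filter_upwards [this.filter_mono (nhdsWithin_mono t fun u (hu : u < t) => hu.ne),
      self_mem_nhdsWithin] with u hu hut
    have hut : u < t := hut
    rw [slope_def_field, div_pos_iff] at hu
    rcases hu with hu | hu <;> linarith [hu.1, hu.2]
  obtain ⟨u, hu, hu'⟩ := (this.and (Ioo_mem_nhdsLT ht.1)).exists
  have := hle ⟨hu'.1.le, hu'.2.le.trans htI.2⟩
  linarith

theorem exists_first_eq (hf : ContinuousOn f (Icc a b)) (ha : f a < c) (hb : c ≤ f b)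
    (hab : a ≤ b) : ∃ t ∈ Ioc a b, f t = c ∧ ∀ u ∈ Icc a t, f u ≤ c := by
  have hcl : IsCompact (Icc a b ∩ f ⁻¹' {c}) :=
    isCompact_Icc.of_isClosed_subset (hf.preimage_isClosed_of_isClosed isClosed_Icc
      isClosed_singleton) inter_subset_left
  have hne : (Icc a b ∩ f ⁻¹' {c}).Nonempty := by
    obtain ⟨t, ht, h⟩ := intermediate_value_Icc hab hf ⟨ha.le, hb⟩
    exact ⟨t, ht, h⟩
  obtain ⟨t, ⟨⟨htI, htc⟩, hmin⟩⟩ := hcl.exists_isLeast hne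
  have htc : f t = c := htc
  refine ⟨t, ⟨lt_of_le_of_ne htI.1 ?_, htI.2⟩, htc, fun u hu => ?_⟩
  · rintro rfl; exact ha.ne htc
  · by_contra! hlt
    obtain ⟨v, hv, hvc⟩ := intermediate_value_Icc hu.1
      (hf.mono (Icc_subset_Icc_right (hu.2.trans htI.2))) ⟨ha.le, hlt.le⟩
    have : t ≤ v := hmin ⟨⟨hv.1, hv.2.trans (hu.2.trans htI.2)⟩, hvc⟩
    have : u = t := le_antisymm hu.2 (this.trans hv.2)
    subst this
    exact hlt.ne' htc

end Calculus

/-! ### Shots from the axis and the shape of a returning arc. -/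

section Shooting

open Set Real

/-- The curvature of a profile curve at the point `(x, r)` with tangent angle `θ`. -/
noncomputable def profileCurv (m : ℕ) (lam d x r θ : ℝ) : ℝ :=
  lam + x * sin θ + (m / max r d - r) * cos θ

/-- `(x, r, θ)` is the profile curve shot horizontally from the point `(0, δ)`. -/
structure IsShot (m : ℕ) (lam d δ S : ℝ) (x r θ : ℝ → ℝ) : Prop where
  d_pos : 0 < d
  d_le : d ≤ δ
  x_zero : x 0 = 0
  r_zero : r 0 = δ
  θ_zero : θ 0 = 0
  hasDerivAt_x : ∀ t ∈ Icc 0 S, HasDerivAt x (cos (θ t)) t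
  hasDerivAt_r : ∀ t ∈ Icc 0 S, HasDerivAt r (sin (θ t)) t
  hasDerivAt_θ : ∀ t ∈ Icc 0 S, HasDerivAt θ (profileCurv m lam d (x t) (r t) (θ t)) t

/-- The curve turns monotonically to the vertical direction at time `s₁`, and then its tangent
angle stays between `π / 2` and `π` until the time `s`. -/
structure IsTurn (m : ℕ) (lam d : ℝ) (x r θ : ℝ → ℝ) (s₁ s : ℝ) : Prop where
  pos : 0 < s₁
  lt : s₁ < s
  θ_eq : θ s₁ = π / 2
  curv_pos : ∀ t ∈ Icc 0 s₁, 0 < profileCurv m lam d (x t) (r t) (θ t)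
  θ_pos : ∀ t ∈ Ioc 0 s₁, 0 < θ t
  θ_lt : ∀ t ∈ Ico 0 s₁, θ t < π / 2
  lt_θ : ∀ t ∈ Ioc s₁ s, π / 2 < θ t
  θ_lt_pi : ∀ t ∈ Ico 0 s, θ t < π
  θ_le_pi : θ s ≤ π

variable {m : ℕ} {lam d δ S : ℝ} {x r θ : ℝ → ℝ} {s s₁ : ℝ}

/-- The angle `π / 2` is a barrier: by `hA` the curvature is positive there, so once reached it is
never recrossed. Before that the curvature is positive and `θ` increases from `0`. Staying below `π
/ 2` is impossible, since `x` would increase and be positive at `s`. -/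
theorem IsShot.exists_isTurn (h : IsShot m lam d δ S x r θ) (hs : 0 < s) (hsS : s ≤ S)
    (hA : ∀ t ∈ Icc 0 s, 0 < profileCurv m lam d (x t) (r t) (θ t) ∨ π / 2 < θ t)
    (hπ : ∀ t ∈ Ico 0 s, θ t < π) (hx : x s ≤ 0) : ∃ s₁, IsTurn m lam d x r θ s₁ s := by
  have hsub : Icc 0 s ⊆ Icc 0 S := Icc_subset_Icc_right hsS
  have hθ : ∀ t ∈ Icc 0 s, HasDerivAt θ (profileCurv m lam d (x t) (r t) (θ t)) t :=
    fun t ht => h.hasDerivAt_θ t (hsub ht)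
  have hc : ContinuousOn θ (Icc 0 s) := fun t ht => (hθ t ht).continuousAt.continuousWithinAt
  have stay : ∀ a ∈ Icc 0 s, π / 2 ≤ θ a → ∀ t ∈ Ioc a s, π / 2 < θ t := by
    intro a ha hθa t ht
    refine lt_of_deriv_pos_of_eq (fun u hu => hθ u ⟨ha.1.trans hu.1, hu.2⟩) hθa ?_ ht
    intro u hu hu'
    rcases hA u ⟨ha.1.trans hu.1, hu.2⟩ with h1 | h1
    · exact h1
    · exact absurd hu' h1.ne'
  have hmono : ∀ b ∈ Icc 0 s, θ b ≤ π / 2 →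
      (∀ t ∈ Icc 0 b, 0 < profileCurv m lam d (x t) (r t) (θ t)) ∧
      (∀ t ∈ Ioc 0 b, 0 < θ t) ∧ ∀ t ∈ Ico 0 b, θ t < π / 2 := by
    intro b hb hθb
    have hle : ∀ t ∈ Icc 0 b, θ t ≤ π / 2 := by
      intro t ht
      by_contra! hlt
      have htb : t < b := lt_of_le_of_ne ht.2 (by rintro rfl; linarith)
      linarith [stay t ⟨ht.1, ht.2.trans hb.2⟩ hlt.le b ⟨htb, hb.2⟩]
    have hk : ∀ t ∈ Icc 0 b, 0 < profileCurv m lam d (x t) (r t) (θ t) := fun t ht =>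
      (hA t ⟨ht.1, ht.2.trans hb.2⟩).resolve_right (hle t ht).not_gt
    refine ⟨hk, fun t ht => ?_, fun t ht => ?_⟩
    · have := lt_of_deriv_pos ht.1 (fun u hu => hθ u ⟨hu.1, hu.2.trans (ht.2.trans hb.2)⟩)
        (fun u hu => hk u ⟨hu.1.le, hu.2.le.trans ht.2⟩)
      rwa [h.θ_zero] at this
    · exact (lt_of_deriv_pos ht.2 (fun u hu => hθ u ⟨ht.1.trans hu.1, hu.2.trans hb.2⟩)
        (fun u hu => hk u ⟨ht.1.trans hu.1.le, hu.2.le⟩)).trans_le hθb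
  have hs_mem : s ∈ Icc 0 s := right_mem_Icc.2 hs.le
  have hθs : π / 2 < θ s := by
    by_contra! hle
    obtain ⟨-, h1, h2⟩ := hmono s hs_mem hle
    have := lt_of_deriv_pos hs (fun u hu => h.hasDerivAt_x u (hsub hu)) fun u hu =>
      cos_pos_of_mem_Ioo ⟨by linarith [h1 u ⟨hu.1, hu.2.le⟩, pi_pos], h2 u ⟨hu.1.le, hu.2⟩⟩
    rw [h.x_zero] at this
    linarith
  obtain ⟨s₁, hs₁, hθ₁⟩ := intermediate_value_Icc hs.le hc
    (show π / 2 ∈ Icc (θ 0) (θ s) from ⟨by rw [h.θ_zero]; positivity, hθs.le⟩)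
  obtain ⟨h1, h2, h3⟩ := hmono s₁ hs₁ hθ₁.le
  refine ⟨s₁, lt_of_le_of_ne hs₁.1 ?_, lt_of_le_of_ne hs₁.2 ?_, hθ₁, h1, h2, h3,
    stay s₁ hs₁ hθ₁.ge, hπ, ?_⟩
  · rintro rfl
    rw [h.θ_zero] at hθ₁
    linarith [pi_pos]
  · rintro rfl
    exact hθs.ne' hθ₁
  -- The strict bound is known on `[0, s)` only; continuity gives the weak one at `s`.
  · have h1 : s ∈ closure (Ico 0 s) := by rw [closure_Ico hs.ne]; exact hs_mem
    exact closure_minimal (s := Ico 0 s) (t := Icc 0 s ∩ θ ⁻¹' Iic π)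
      (fun t ht => ⟨Ico_subset_Icc_self ht, (hπ t ht).le⟩)
      (hc.preimage_isClosed_of_isClosed isClosed_Icc isClosed_Iic) h1 |>.2

namespace IsTurn

variable (hT : IsTurn m lam d x r θ s₁ s)
include hT

theorem s_pos : 0 < s := hT.pos.trans hT.lt

theorem lower : ∀ t ∈ Icc 0 s₁, θ t ≤ π / 2 := fun t ht => by
  rcases ht.2.eq_or_lt with rfl | h
  · exact hT.θ_eq.le
  · exact (hT.θ_lt t ⟨ht.1, h⟩).le

theorem upper : ∀ t ∈ Icc s₁ s, π / 2 ≤ θ t := fun t ht => by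
  rcases ht.1.eq_or_lt with rfl | h
  · exact hT.θ_eq.ge
  · exact (hT.lt_θ t ⟨h, ht.2⟩).le

theorem θ_pos' : ∀ t ∈ Ioc 0 s, 0 < θ t := fun t ht => by
  rcases le_total t s₁ with h | h
  · exact hT.θ_pos t ⟨ht.1, h⟩
  · linarith [hT.upper t ⟨h, ht.2⟩, pi_pos]

theorem θ_le_pi' : ∀ t ∈ Icc 0 s, θ t ≤ π := fun t ht => by
  rcases ht.2.eq_or_lt with rfl | h
  · exact hT.θ_le_pi
  · exact (hT.θ_lt_pi t ⟨ht.1, h⟩).le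

theorem mono_right {s' : ℝ} (h1 : s₁ < s') (h2 : s' ≤ s) : IsTurn m lam d x r θ s₁ s' where
  pos := hT.pos
  lt := h1
  θ_eq := hT.θ_eq
  curv_pos := hT.curv_pos
  θ_pos := hT.θ_pos
  θ_lt := hT.θ_lt
  lt_θ := fun t ht => hT.lt_θ t ⟨ht.1, ht.2.trans h2⟩
  θ_lt_pi := fun t ht => hT.θ_lt_pi t ⟨ht.1, ht.2.trans_le h2⟩
  θ_le_pi := hT.θ_le_pi' s' ⟨(hT.pos.trans h1).le, h2⟩

end IsTurn

namespace IsShot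

variable (h : IsShot m lam d δ S x r θ)
include h

theorem δ_pos : 0 < δ := h.d_pos.trans_le h.d_le

theorem abs_x_le {t : ℝ} (ht : t ∈ Icc 0 S) : |x t| ≤ t := by
  have hd : ∀ u ∈ Icc 0 t, HasDerivAt x (cos (θ u)) u :=
    fun u hu => h.hasDerivAt_x u ⟨hu.1, hu.2.trans ht.2⟩
  have h1 := sub_le_mul_of_deriv_le ht.1 hd fun u _ => cos_le_one _
  have h2 := mul_le_sub_of_le_deriv ht.1 hd fun u _ => neg_one_le_cos _
  rw [h.x_zero] at h1 h2
  exact abs_le.2 ⟨by linarith, by linarith⟩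

theorem r_le {t : ℝ} (ht : t ∈ Icc 0 S) : r t ≤ δ + t := by
  have h1 := sub_le_mul_of_deriv_le ht.1
    (fun u hu => h.hasDerivAt_r u ⟨hu.1, hu.2.trans ht.2⟩) fun u _ => sin_le_one _
  rw [h.r_zero] at h1
  linarith

theorem le_r {t : ℝ} (ht : t ∈ Icc 0 S) (hθ : ∀ u ∈ Icc 0 t, 0 ≤ θ u ∧ θ u ≤ π) : δ ≤ r t := by
  have h1 := mul_le_sub_of_le_deriv (c := 0) ht.1
    (fun u hu => h.hasDerivAt_r u ⟨hu.1, hu.2.trans ht.2⟩)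
    fun u hu => sin_nonneg_of_nonneg_of_le_pi (hθ u hu).1 (hθ u hu).2
  rw [h.r_zero] at h1
  linarith

variable (hT : IsTurn m lam d x r θ s₁ s) (hsS : s ≤ S)
include hT

theorem θ_mem {t : ℝ} (ht : t ∈ Icc 0 s) : 0 ≤ θ t ∧ θ t ≤ π := by
  refine ⟨?_, hT.θ_le_pi' t ht⟩
  rcases ht.1.eq_or_lt with rfl | h0
  · exact h.θ_zero.ge
  · exact (hT.θ_pos' t ⟨h0, ht.2⟩).le

include hsS

theorem r_strictMonoOn : StrictMonoOn r (Icc 0 s) := fun _ ha _ hb hab =>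
  lt_of_deriv_pos hab (fun u hu => h.hasDerivAt_r u ⟨ha.1.trans hu.1, hu.2.trans (hb.2.trans hsS)⟩)
    fun u hu => sin_pos_of_pos_of_lt_pi (hT.θ_pos' u ⟨ha.1.trans_lt hu.1, hu.2.le.trans hb.2⟩)
      (hT.θ_lt_pi u ⟨ha.1.trans hu.1.le, hu.2.trans_le hb.2⟩)

theorem δ_le_r {t : ℝ} (ht : t ∈ Icc 0 s) : δ ≤ r t :=
  h.le_r ⟨ht.1, ht.2.trans hsS⟩ fun _ hu => h.θ_mem hT ⟨hu.1, hu.2.trans ht.2⟩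

theorem x_strictMonoOn : StrictMonoOn x (Icc 0 s₁) := fun _ ha _ hb hab =>
  lt_of_deriv_pos hab
    (fun u hu => h.hasDerivAt_x u ⟨ha.1.trans hu.1, (hu.2.trans hb.2).trans (hT.lt.le.trans hsS)⟩)
    fun u hu => cos_pos_of_mem_Ioo ⟨by
      linarith [hT.θ_pos u ⟨ha.1.trans_lt hu.1, hu.2.le.trans hb.2⟩, pi_pos],
      hT.θ_lt u ⟨ha.1.trans hu.1.le, hu.2.trans_le hb.2⟩⟩

theorem x_strictAntiOn : StrictAntiOn x (Icc s₁ s) := fun a ha b hb hab => by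
  have := lt_of_deriv_pos (f := fun t => -x t) hab
    (fun u hu => (h.hasDerivAt_x u ⟨hT.pos.le.trans (ha.1.trans hu.1),
      (hu.2.trans hb.2).trans hsS⟩).neg)
    fun u hu => neg_pos.2 (cos_neg_of_pi_div_two_lt_of_lt
      (hT.lt_θ u ⟨ha.1.trans_lt hu.1, hu.2.le.trans hb.2⟩) (by
        linarith [hT.θ_le_pi' u ⟨hT.pos.le.trans (ha.1.trans hu.1.le), hu.2.le.trans hb.2⟩, pi_pos]))
  simpa using this

theorem x_pos (hx : 0 ≤ x s) {t : ℝ} (ht : t ∈ Ioo 0 s) : 0 < x t := by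
  rcases le_total t s₁ with h1 | h1
  · have := h.x_strictMonoOn hT hsS ⟨le_rfl, hT.pos.le⟩ ⟨ht.1.le, h1⟩ ht.1
    rwa [h.x_zero] at this
  · exact hx.trans_lt (h.x_strictAntiOn hT hsS ⟨h1, ht.2.le⟩ ⟨hT.lt.le, le_rfl⟩ ht.2)

theorem x_nonneg (hx : 0 ≤ x s) {t : ℝ} (ht : t ∈ Icc 0 s) : 0 ≤ x t := by
  rcases ht.1.eq_or_lt with rfl | h0
  · exact h.x_zero.ge
  rcases ht.2.eq_or_lt with rfl | h1
  · exact hx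
  · exact (h.x_pos hT hsS hx ⟨h0, h1⟩).le

end IsShot

end Shooting

/-! ### A uniform bound for the return time. -/

section Bounds

open Set Real

variable {m : ℕ} {lam d δ S : ℝ} {x r θ : ℝ → ℝ} {s s₁ : ℝ}

/-- A bound for the time that a profile curve shot from a height at most `D` needs to return to
the axis. -/
noncomputable def returnTimeBound (m : ℕ) (lam D : ℝ) : ℝ :=
  D * (exp (π / lam ^ 2 + 1) - 1) + π / lam + (π / lam + √m)

namespace IsShot

variable (h : IsShot m lam d δ S x r θ) (hT : IsTurn m lam d x r θ s₁ s) (hsS : s ≤ S)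
  (hx : 0 ≤ x s) (hlam : 0 < lam)
include h hT

theorem sin_θ_nonneg {t : ℝ} (ht : t ∈ Icc 0 s) : 0 ≤ sin (θ t) :=
  sin_nonneg_of_nonneg_of_le_pi (h.θ_mem hT ht).1 (h.θ_mem hT ht).2

theorem cos_θ_nonneg {t : ℝ} (ht : t ∈ Icc 0 s₁) : 0 ≤ cos (θ t) :=
  cos_nonneg_of_mem_Icc ⟨by
    linarith [(h.θ_mem hT ⟨ht.1, ht.2.trans hT.lt.le⟩).1, pi_pos], hT.lower t ht⟩

theorem cos_θ_nonpos {t : ℝ} (ht : t ∈ Icc s₁ s) : cos (θ t) ≤ 0 :=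
  cos_nonpos_of_pi_div_two_le_of_le (hT.upper t ht) (by
    linarith [(h.θ_mem hT ⟨hT.pos.le.trans ht.1, ht.2⟩).2, pi_pos])

include hsS

theorem max_eq {t : ℝ} (ht : t ∈ Icc 0 s) : max (r t) d = r t :=
  max_eq_left (h.d_le.trans (h.δ_le_r hT hsS ht))

theorem r_pos {t : ℝ} (ht : t ∈ Icc 0 s) : 0 < r t := h.δ_pos.trans_le (h.δ_le_r hT hsS ht)

include hx

/-- Every term of the curvature other than `lam` is nonnegative: `x sin θ` is, and before the turn
`cos θ` has the same sign as `m / r - r` while `r² ≤ m`. -/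
theorem lam_le_curv_of_early {t : ℝ} (ht : t ∈ Icc 0 s₁) (hr : r t ^ 2 ≤ m) :
    lam ≤ profileCurv m lam d (x t) (r t) (θ t) := by
  have ht' : t ∈ Icc 0 s := ⟨ht.1, ht.2.trans hT.lt.le⟩
  have h1 := h.x_nonneg hT hsS hx ht'
  have h2 := h.r_pos hT hsS ht'
  have h3 : 0 ≤ (m : ℝ) / r t - r t := by
    rw [sub_nonneg, le_div_iff₀ h2]; nlinarith
  have h4 := mul_nonneg h1 (h.sin_θ_nonneg hT ht')
  have h5 := mul_nonneg h3 (h.cos_θ_nonneg hT ht)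
  rw [profileCurv, h.max_eq hT hsS ht']
  linarith

/-- After the turn `cos θ ≤ 0`, so the favourable sign of `m / r - r` is now the one for `r² ≥ m`.
-/
theorem lam_le_curv_of_late {t : ℝ} (ht : t ∈ Icc s₁ s) (hr : (m : ℝ) ≤ r t ^ 2) :
    lam ≤ profileCurv m lam d (x t) (r t) (θ t) := by
  have ht' : t ∈ Icc 0 s := ⟨hT.pos.le.trans ht.1, ht.2⟩
  have h1 := h.x_nonneg hT hsS hx ht'
  have h2 := h.r_pos hT hsS ht'
  have h3 : (m : ℝ) / r t - r t ≤ 0 := by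
    rw [sub_nonpos, div_le_iff₀ h2]; nlinarith
  have h4 := mul_nonneg h1 (h.sin_θ_nonneg hT ht')
  have h5 := mul_nonneg_of_nonpos_of_nonpos h3 (h.cos_θ_nonpos hT ht)
  rw [profileCurv, h.max_eq hT hsS ht']
  linarith

include hlam

/-- As `r` increases, `r² ≥ m` persists, so `θ` grows at rate at least `lam` and has at most `π / 2`
left to grow. -/
theorem late_duration_le {a : ℝ} (ha : a ∈ Icc s₁ s) (hr : (m : ℝ) ≤ r a ^ 2) :
    s - a ≤ π / (2 * lam) := by
  have h0 : 0 ≤ a := hT.pos.le.trans ha.1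
  have h1 := mul_le_sub_of_le_deriv (c := lam) ha.2
    (fun u hu => h.hasDerivAt_θ u ⟨h0.trans hu.1, hu.2.trans hsS⟩) fun u hu =>
      h.lam_le_curv_of_late hT hsS hx ⟨ha.1.trans hu.1, hu.2⟩ (by
        have := (h.r_strictMonoOn hT hsS).monotoneOn ⟨h0, ha.2⟩ ⟨h0.trans hu.1, hu.2⟩ hu.1
        have h2 := h.r_pos hT hsS ⟨h0, ha.2⟩
        nlinarith)
  have h2 := hT.upper a ha
  have h3 := hT.θ_le_pi
  rw [le_div_iff₀ (by positivity)]
  linarith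

/-- If `r² ≤ m` at the turn, the whole early phase has curvature at least `lam`; otherwise the whole
late phase has. The phase in question lasts at most `π / (2 * lam)`, and at unit speed `x` cannot
rise from, or fall to, `0` by more than that. -/
theorem x_turn_le (hx0 : x s = 0) : x s₁ ≤ π / (2 * lam) := by
  have hs₁ : s₁ ∈ Icc 0 s := ⟨hT.pos.le, hT.lt.le⟩
  rcases le_total (r s₁ ^ 2) m with hr | hr
  · have h1 := mul_le_sub_of_le_deriv (c := lam) hT.pos.le
      (fun u hu => h.hasDerivAt_θ u ⟨hu.1, hu.2.trans (hT.lt.le.trans hsS)⟩) fun u hu =>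
        h.lam_le_curv_of_early hT hsS hx hu (by
          have := (h.r_strictMonoOn hT hsS).monotoneOn ⟨hu.1, hu.2.trans hT.lt.le⟩ hs₁ hu.2
          have h2 := h.r_pos hT hsS ⟨hu.1, hu.2.trans hT.lt.le⟩
          nlinarith)
    rw [h.θ_zero, hT.θ_eq] at h1
    have h2 := (le_abs_self _).trans (h.abs_x_le ⟨hs₁.1, hs₁.2.trans hsS⟩)
    refine h2.trans ?_
    rw [le_div_iff₀ (by positivity)]
    linarith
  · have h1 := h.late_duration_le hT hsS hx hlam ⟨le_rfl, hT.lt.le⟩ hr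
    have h2 := mul_le_sub_of_le_deriv (c := -1) hT.lt.le
      (fun u hu => h.hasDerivAt_x u ⟨hs₁.1.trans hu.1, hu.2.trans hsS⟩)
      fun u _ => neg_one_le_cos _
    linarith

/-- After the turn `r - x` grows at rate `sin θ - cos θ ≥ 1`. Since `x` is at most `π / (2 * lam)`
at the turn, `r` exceeds `√m` after a further time `π / (2 * lam) + √m`, and then `late_duration_le`
applies. -/
theorem upper_duration_le (hx0 : x s = 0) : s - s₁ ≤ π / lam + √m := by
  have hC : π / lam = π / (2 * lam) + π / (2 * lam) := by field_simp; norm_num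
  have hC0 : 0 < π / (2 * lam) := by positivity
  by_contra! hlt
  have hm0 : 0 ≤ √m := sqrt_nonneg _
  set a := s₁ + (π / (2 * lam) + √m) with ha_def
  have ha : a ∈ Icc s₁ s := ⟨by linarith, by linarith⟩
  have hd : ∀ u ∈ Icc s₁ a, HasDerivAt (fun t => r t - x t) (sin (θ u) - cos (θ u)) u := by
    intro u hu
    have hu' : u ∈ Icc 0 S := ⟨hT.pos.le.trans hu.1, (hu.2.trans ha.2).trans hsS⟩
    exact (h.hasDerivAt_r u hu').sub (h.hasDerivAt_x u hu')
  have h1 := mul_le_sub_of_le_deriv (c := 1) ha.1 hd fun u hu => by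
    have h1 := h.sin_θ_nonneg hT ⟨hT.pos.le.trans hu.1, hu.2.trans ha.2⟩
    have h2 := h.cos_θ_nonpos hT ⟨hu.1, hu.2.trans ha.2⟩
    nlinarith [sin_sq_add_cos_sq (θ u), mul_nonneg h1 (neg_nonneg.2 h2)]
  have h2 := h.x_turn_le hT hsS hx hlam hx0
  have h3 := h.x_nonneg hT hsS hx ⟨hT.pos.le.trans ha.1, ha.2⟩
  have h4 := h.r_pos hT hsS ⟨hT.pos.le, hT.lt.le⟩
  have h5 : √m ≤ r a := by linarith
  have h6 : (m : ℝ) ≤ r a ^ 2 := by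
    have := mul_self_sqrt (Nat.cast_nonneg (α := ℝ) m)
    nlinarith
  have := h.late_duration_le hT hsS hx hlam ha h6
  linarith

theorem lower_duration_le {D : ℝ} (hD : δ ≤ D) (hx0 : x s = 0) :
    s₁ ≤ D * (exp (π / lam ^ 2 + 1) - 1) + π / lam := by
  -- This `T` makes `lam / 2 * log ((D + T) / D)` equal to `π / (2 * lam) + lam / 2`, more than `x`
  -- can reach by `x_turn_le`.
  set T := D * (exp (π / lam ^ 2 + 1) - 1) with hTdef
  have hD0 : 0 < D := h.δ_pos.trans_le hD
  have hT0 : 0 ≤ T := mul_nonneg hD0.le (sub_nonneg.2 (one_le_exp (by positivity)))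
  by_contra! hlt
  have hTs₁ : T < s₁ := by linarith [show 0 < π / lam by positivity]
  have hmem : ∀ u ∈ Icc 0 s₁, u ∈ Icc 0 s := fun u hu => ⟨hu.1, hu.2.trans hT.lt.le⟩
  have hmemS : ∀ u ∈ Icc 0 s₁, u ∈ Icc 0 S := fun u hu => ⟨hu.1, (hmem u hu).2.trans hsS⟩
  -- The support function of the curve. The curvature is `lam - p + (m / r) cos θ`, and `p`
  -- decreases before the turn. So either `p` has dropped to `lam / 2` by time `T`, after which `θ'
  -- ≥ lam / 2`, or `r cos θ > lam / 2` up to `T`, which forces logarithmic growth of `x`.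
  let p : ℝ → ℝ := fun t => r t * cos (θ t) - x t * sin (θ t)
  let κ : ℝ → ℝ := fun t => profileCurv m lam d (x t) (r t) (θ t)
  have hp : ∀ u ∈ Icc 0 s₁,
      HasDerivAt p (-(κ u * (r u * sin (θ u) + x u * cos (θ u)))) u := by
    intro u hu
    have e1 := h.hasDerivAt_x u (hmemS u hu)
    have e2 := h.hasDerivAt_r u (hmemS u hu)
    have e3 := h.hasDerivAt_θ u (hmemS u hu)
    refine ((e2.mul e3.cos).sub (e1.mul e3.sin)).congr_deriv ?_
    simp only [κ]; ring
  have hp_anti : ∀ a ∈ Icc 0 s₁, ∀ b ∈ Icc 0 s₁, a ≤ b → p b ≤ p a := by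
    intro a ha b hb hab
    have := sub_le_mul_of_deriv_le (c := 0) hab (fun u hu => hp u ⟨ha.1.trans hu.1, hu.2.trans hb.2⟩)
      fun u hu => by
        have hu' : u ∈ Icc 0 s₁ := ⟨ha.1.trans hu.1, hu.2.trans hb.2⟩
        have h1 := mul_nonneg (h.r_pos hT hsS (hmem u hu')).le (h.sin_θ_nonneg hT (hmem u hu'))
        have h2 := mul_nonneg (h.x_nonneg hT hsS hx (hmem u hu')) (h.cos_θ_nonneg hT hu')
        have h3 := mul_nonneg (hT.curv_pos u hu').le (add_nonneg h1 h2)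
        simpa [κ] using h3
    linarith
  have hTm : T ∈ Icc 0 s₁ := ⟨hT0, hTs₁.le⟩
  rcases le_or_gt (p T) (lam / 2) with hpT | hpT
  · have h1 := mul_le_sub_of_le_deriv (c := lam / 2) hTs₁.le
      (fun u hu => h.hasDerivAt_θ u (hmemS u ⟨hT0.trans hu.1, hu.2⟩)) fun u hu => by
        have hu' : u ∈ Icc 0 s₁ := ⟨hT0.trans hu.1, hu.2⟩
        have h1 := hp_anti T hTm u hu' hu.1
        have h2 : 0 ≤ (m : ℝ) / r u := div_nonneg (Nat.cast_nonneg _) (h.r_pos hT hsS (hmem u hu')).le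
        have h3 := mul_nonneg h2 (h.cos_θ_nonneg hT hu')
        rw [profileCurv, h.max_eq hT hsS (hmem u hu')]
        simp only [p] at h1 hpT
        linarith
    have h2 := (h.θ_mem hT (hmem T hTm)).1
    rw [hT.θ_eq] at h1
    have h3 : s₁ - T ≤ π / lam := by
      rw [le_div_iff₀ hlam]; linarith
    linarith
  · have hlog : ∀ u ∈ Icc 0 T, HasDerivAt (fun t => lam / 2 * log (D + t)) (lam / 2 * (1 / (D + u))) u := by
      intro u hu
      have : HasDerivAt (fun t => D + t) 1 u := by simpa using (hasDerivAt_id u).const_add D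
      exact (this.log (by linarith [hu.1])).const_mul _
    have h1 := sub_le_sub_of_deriv_le hT0 hlog
      (fun u hu => h.hasDerivAt_x u (hmemS u ⟨hu.1, hu.2.trans hTs₁.le⟩)) fun u hu => by
        have hu' : u ∈ Icc 0 s₁ := ⟨hu.1, hu.2.trans hTs₁.le⟩
        have h1 := hp_anti u hu' T hTm hu.2
        have h2 := mul_nonneg (h.x_nonneg hT hsS hx (hmem u hu')) (h.sin_θ_nonneg hT (hmem u hu'))
        have h3 := h.r_le (hmemS u hu')
        have h4 := h.cos_θ_nonneg hT hu'
        have h5 : r u * cos (θ u) ≤ (D + u) * cos (θ u) :=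
          mul_le_mul_of_nonneg_right (by linarith) h4
        simp only [p] at h1 hpT
        rw [mul_one_div, div_le_iff₀ (by linarith [hu.1])]
        linarith
    have e1 : D + T = D * exp (π / lam ^ 2 + 1) := by rw [hTdef]; ring
    rw [e1, log_mul hD0.ne' (exp_ne_zero _), log_exp, add_zero, h.x_zero] at h1
    have h2 := (h.x_strictMonoOn hT hsS hTm ⟨hT.pos.le, le_rfl⟩ hTs₁).trans_le
      (h.x_turn_le hT hsS hx hlam hx0)
    have e2 : lam / 2 * (π / lam ^ 2) = π / (2 * lam) := by field_simp
    nlinarith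

theorem duration_le {D : ℝ} (hD : δ ≤ D) (hx0 : x s = 0) : s ≤ returnTimeBound m lam D := by
  have h1 := h.lower_duration_le hT hsS hx hlam hD hx0
  have h2 := h.upper_duration_le hT hsS hx hlam hx0
  unfold returnTimeBound
  linarith

end IsShot

end Bounds

/-! ### Shots from small heights cross the axis early. -/

section SmallHeight

open Set Real

variable {m : ℕ} {lam d δ S : ℝ} {x r θ : ℝ → ℝ}

/-- The factor `r ^ m` is an integrating factor that cancels the singular term `m / r`. What remains
is comparable with the derivative of `r ^ (m + 1)`, giving estimates uniform in `δ`. -/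
theorem IsShot.hasDerivAt_pow_mul_cos (h : IsShot m lam d δ S x r θ) (hm : 1 ≤ m) {u : ℝ}
    (hu : u ∈ Icc 0 S) (hr : δ ≤ r u) :
    HasDerivAt (fun t => r t ^ m * cos (θ t))
      (-(r u ^ m * sin (θ u) * (lam + x u * sin (θ u) - r u * cos (θ u)))) u := by
  have hr0 : 0 < r u := h.δ_pos.trans_le hr
  obtain ⟨k, rfl⟩ : ∃ k, m = k + 1 := ⟨m - 1, by omega⟩
  refine (((h.hasDerivAt_r u hu).pow (k + 1)).mul (h.hasDerivAt_θ u hu).cos).congr_deriv ?_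
  rw [profileCurv, max_eq_left (h.d_le.trans hr)]
  simp only [Nat.add_sub_cancel, Pi.pow_apply]
  field_simp
  ring

theorem IsShot.hasDerivAt_pow_succ (h : IsShot m lam d δ S x r θ) (c : ℝ) {u : ℝ}
    (hu : u ∈ Icc 0 S) :
    HasDerivAt (fun t => c * r t ^ (m + 1)) (c * (m + 1) * r u ^ m * sin (θ u)) u := by
  refine (((h.hasDerivAt_r u hu).pow (m + 1)).const_mul c).congr_deriv ?_
  push_cast
  ring

theorem one_div_sixteen_le_sin {a : ℝ} (h1 : 1 / 8 ≤ a) (h2 : a ≤ 3 * π / 4) : 1 / 16 ≤ sin a := by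
  have hπ := pi_le_four
  have hπ0 := pi_pos
  rcases le_total a (π / 2) with h | h
  · refine le_trans ?_ (mul_le_sin (by linarith) h)
    rw [div_mul_eq_mul_div, le_div_iff₀ hπ0]
    linarith
  · rw [← sin_pi_sub]
    refine le_trans ?_ (mul_le_sin (by linarith) (by linarith))
    rw [div_mul_eq_mul_div, le_div_iff₀ hπ0]
    linarith

/-- Conditions on a short time `H` that allow to control, up to that time, every profile curve shot
from a height at most `H`. -/
structure IsShortTime (lam H : ℝ) : Prop where
  pos : 0 < H
  le_eighth : H ≤ 1 / 8
  le_lam : 6 * H ≤ lam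
  mul_le : 3 * lam * H ≤ 1

theorem exists_isShortTime {lam : ℝ} (hlam : 0 < lam) : ∃ H, IsShortTime lam H := by
  refine ⟨min (1 / 8) (min (lam / 6) (1 / (3 * lam))), by positivity, min_le_left _ _, ?_, ?_⟩
  · linarith [(min_le_right (1 / 8) (min (lam / 6) (1 / (3 * lam)))).trans (min_le_left _ _)]
  · have := (min_le_right (1 / 8) (min (lam / 6) (1 / (3 * lam)))).trans (min_le_right _ _)
    rwa [le_div_iff₀ (by positivity), mul_comm] at this

namespace IsShot

variable {H : ℝ} (h : IsShot m lam d δ S x r θ) (hm : 1 ≤ m) (hH : IsShortTime lam H)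
  (hHS : H ≤ S) (hδH : δ ≤ H)
include h hm hH hHS hδH

theorem short_bounds {t : ℝ} (ht : t ∈ Icc 0 H) :
    |x t * sin (θ t)| ≤ H ∧ r t ≤ 2 * H ∧ r t ≤ m / max (r t) d := by
  have htS : t ∈ Icc 0 S := ⟨ht.1, ht.2.trans hHS⟩
  have h1 := h.abs_x_le htS
  have h2 := h.r_le htS
  have h3 : r t ≤ 2 * H := by linarith [ht.2]
  refine ⟨?_, h3, ?_⟩
  · rw [abs_mul]
    nlinarith [abs_sin_le_one (θ t), abs_nonneg (x t), abs_nonneg (sin (θ t)), ht.2]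
  · have hd := h.d_pos
    have h4 : max (r t) d ≤ 1 := max_le (by linarith [hH.le_eighth])
      (by linarith [hH.le_eighth, h.d_le])
    have h5 : 0 < max (r t) d := hd.trans_le (le_max_right _ _)
    have hm' : (1 : ℝ) ≤ m := by exact_mod_cast hm
    rw [le_div_iff₀ h5]
    nlinarith [hH.le_eighth]

theorem short_curv_pos {t : ℝ} (ht : t ∈ Icc 0 H) (hθ : 0 ≤ cos (θ t)) :
    0 < profileCurv m lam d (x t) (r t) (θ t) := by
  obtain ⟨h1, -, h3⟩ := h.short_bounds hm hH hHS hδH ht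
  have h4 := mul_nonneg (sub_nonneg.2 h3) hθ
  have h5 := (abs_le.1 h1).1
  unfold profileCurv
  linarith [hH.pos, hH.le_lam]

theorem short_θ_pos {t : ℝ} (ht : t ∈ Ioc 0 H) : 0 < θ t := by
  refine lt_of_deriv_pos_of_eq (fun u hu => h.hasDerivAt_θ u ⟨hu.1, hu.2.trans hHS⟩)
    h.θ_zero.ge (fun u hu hu0 => ?_) ht
  exact h.short_curv_pos hm hH hHS hδH hu (by rw [hu0, cos_zero]; exact zero_le_one)

theorem short_θ_nonneg {t : ℝ} (ht : t ∈ Icc 0 H) : 0 ≤ θ t := by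
  rcases ht.1.eq_or_lt with rfl | h0
  · exact h.θ_zero.ge
  · exact (h.short_θ_pos hm hH hHS hδH ⟨h0, ht.2⟩).le

/-- At a first time with `θ = 3π / 4`, comparing `r ^ m * cos θ` with a multiple of `r ^ (m + 1)`
gives `cos θ ≥ -(lam + 3 * H) / (m + 1) * r ≥ -1 / 2`, whereas `cos (3π / 4) < -1 / 2`. -/
theorem short_θ_le {t : ℝ} (ht : t ∈ Icc 0 H) : θ t ≤ 3 * π / 4 := by
  by_contra! hlt
  have hπ := pi_pos
  obtain ⟨t₁, ht₁, hθ₁, hle⟩ := exists_first_eq (f := θ) (a := 0) (b := t) (c := 3 * π / 4)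
    (fun u hu => (h.hasDerivAt_θ u ⟨hu.1, hu.2.trans (ht.2.trans hHS)⟩).continuousAt.continuousWithinAt)
    (by rw [h.θ_zero]; positivity) hlt.le ht.1
  have hsub : ∀ u ∈ Icc 0 t₁, u ∈ Icc 0 H := fun u hu => ⟨hu.1, hu.2.trans (ht₁.2.trans ht.2)⟩
  have hsubS : ∀ u ∈ Icc 0 t₁, u ∈ Icc 0 S := fun u hu => ⟨hu.1, (hsub u hu).2.trans hHS⟩
  have hθ : ∀ u ∈ Icc 0 t₁, 0 ≤ θ u ∧ θ u ≤ π := fun u hu =>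
    ⟨h.short_θ_nonneg hm hH hHS hδH (hsub u hu), by linarith [hle u hu]⟩
  have hr : ∀ u ∈ Icc 0 t₁, δ ≤ r u := fun u hu =>
    h.le_r (hsubS u hu) fun v hv => hθ v ⟨hv.1, hv.2.trans hu.2⟩
  have key := sub_le_sub_of_deriv_le ht₁.1.le
    (fun u hu => h.hasDerivAt_pow_succ (-((lam + 3 * H) / (m + 1))) (hsubS u hu))
    (fun u hu => h.hasDerivAt_pow_mul_cos hm (hsubS u hu) (hr u hu)) fun u hu => by
      obtain ⟨h1, h2, -⟩ := h.short_bounds hm hH hHS hδH (hsub u hu)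
      have h3 := sin_nonneg_of_nonneg_of_le_pi (hθ u hu).1 (hθ u hu).2
      have h4 : 0 < r u := h.δ_pos.trans_le (hr u hu)
      have h5 : 0 ≤ r u ^ m * sin (θ u) := mul_nonneg (pow_pos h4 m).le h3
      have h6 : lam + x u * sin (θ u) - r u * cos (θ u) ≤ lam + 3 * H := by
        nlinarith [(abs_le.1 h1).2, neg_one_le_cos (θ u)]
      have h7 : -((lam + 3 * H) / (m + 1)) * ((m : ℝ) + 1) = -(lam + 3 * H) := by
        field_simp
      rw [h7]
      nlinarith
  have hr₁ := hr t₁ ⟨ht₁.1.le, le_rfl⟩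
  have hr0 : 0 < r t₁ := h.δ_pos.trans_le hr₁
  obtain ⟨-, hr2, -⟩ := h.short_bounds hm hH hHS hδH (hsub t₁ ⟨ht₁.1.le, le_rfl⟩)
  rw [h.θ_zero, cos_zero, h.r_zero, hθ₁] at key
  have hδm := pow_pos h.δ_pos m
  have hδm1 := pow_pos h.δ_pos (m + 1)
  have hlamH : 0 < lam + 3 * H := by linarith [hH.pos, hH.le_lam]
  have hc : 0 < (lam + 3 * H) / (m + 1) := by positivity
  have h8 : -((lam + 3 * H) / (m + 1)) * r t₁ ^ (m + 1) ≤ r t₁ ^ m * cos (3 * π / 4) := by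
    nlinarith
  have h9 : -((lam + 3 * H) / (m + 1)) * r t₁ ≤ cos (3 * π / 4) := by
    rw [pow_succ] at h8
    have := pow_pos hr0 m
    by_contra! hlt
    nlinarith
  have h10 : (lam + 3 * H) / (m + 1) ≤ 3 / 4 * lam := by
    have hm' : (1 : ℝ) ≤ m := by exact_mod_cast hm
    have hl : 0 < lam := by linarith [hH.pos, hH.le_lam]
    rw [div_le_iff₀ (by positivity)]
    nlinarith [hH.le_lam]
  have h11 : (lam + 3 * H) / (m + 1) * r t₁ ≤ 1 / 2 := by
    have := mul_le_mul h10 hr2 hr0.le (by linarith [hH.pos, hH.le_lam])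
    linarith [hH.mul_le]
  have h12 : cos (3 * π / 4) = -(√2 / 2) := by
    rw [show 3 * π / 4 = π - π / 4 by ring, cos_pi_sub, cos_pi_div_four]
  have h13 : 1 < √2 := by
    rw [lt_sqrt] <;> norm_num
  rw [h12] at h9
  linarith

theorem short_le_r {t : ℝ} (ht : t ∈ Icc 0 H) : δ ≤ r t :=
  h.le_r ⟨ht.1, ht.2.trans hHS⟩ fun u hu =>
    have hu' : u ∈ Icc 0 H := ⟨hu.1, hu.2.trans ht.2⟩
    ⟨h.short_θ_nonneg hm hH hHS hδH hu',
      by linarith [h.short_θ_le hm hH hHS hδH hu', pi_pos]⟩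

/-- Up to time `δ` one has `r ≤ 2δ`. As long as `θ ≤ 1 / 8`, the term `m / r` then forces `θ' ≥ 1 /
(8δ)`, so the angle `1 / 8` is reached by time `δ`; it is a barrier afterwards. This makes `r` grow
linearly, at a rate independent of `δ`. -/
theorem short_eighth_le_θ {t : ℝ} (ht : t ∈ Icc δ H) : 1 / 8 ≤ θ t := by
  have hδ := h.δ_pos
  have stay : ∀ a ∈ Icc 0 H, 1 / 8 ≤ θ a → ∀ t ∈ Ioc a H, 1 / 8 < θ t := by
    intro a ha hθa t ht
    refine lt_of_deriv_pos_of_eq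
      (fun u hu => h.hasDerivAt_θ u ⟨ha.1.trans hu.1, hu.2.trans hHS⟩) hθa (fun u hu hu' => ?_) ht
    refine h.short_curv_pos hm hH hHS hδH ⟨ha.1.trans hu.1, hu.2⟩ ?_
    rw [hu']
    exact cos_nonneg_of_mem_Icc ⟨by linarith [pi_pos], by linarith [pi_gt_three]⟩
  have hθδ : 1 / 8 ≤ θ δ := by
    by_contra! hlt
    have hle : ∀ u ∈ Icc 0 δ, θ u ≤ 1 / 8 := by
      intro u hu
      by_contra! hu'
      rcases hu.2.eq_or_lt with rfl | huδ
      · linarith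
      · linarith [stay u ⟨hu.1, hu.2.trans hδH⟩ hu'.le δ ⟨huδ, hδH⟩]
    have := mul_le_sub_of_le_deriv (c := 1 / (8 * δ)) hδ.le
      (fun u hu => h.hasDerivAt_θ u ⟨hu.1, hu.2.trans (hδH.trans hHS)⟩) fun u hu => by
        have hu' : u ∈ Icc 0 H := ⟨hu.1, hu.2.trans hδH⟩
        obtain ⟨h1, h2, -⟩ := h.short_bounds hm hH hHS hδH hu'
        have hr := h.short_le_r hm hH hHS hδH hu'
        have hr2 := h.r_le ⟨hu.1, hu.2.trans (hδH.trans hHS)⟩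
        have hr0 : 0 < r u := hδ.trans_le hr
        have hθ0 := h.short_θ_nonneg hm hH hHS hδH hu'
        have hcos : 1 / 2 ≤ cos (θ u) := by
          nlinarith [one_sub_sq_div_two_le_cos (x := θ u), hle u hu]
        have hm' : (1 : ℝ) ≤ m := by exact_mod_cast hm
        have h3 : 1 / (2 * r u) ≤ m / r u - r u := by
          rw [le_sub_iff_add_le, le_div_iff₀ hr0, add_mul,
            show 1 / (2 * r u) * r u = 1 / 2 by field_simp]
          nlinarith [hH.le_eighth]
        have h4 : 1 / (8 * δ) ≤ 1 / (2 * r u) * (1 / 2) := by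
          rw [one_div_mul_one_div]
          exact one_div_le_one_div_of_le (by positivity) (by linarith [hu.2])
        have h5 : 1 / (2 * r u) * (1 / 2) ≤ (m / r u - r u) * cos (θ u) :=
          mul_le_mul h3 hcos (by norm_num) (le_trans (by positivity) h3)
        rw [profileCurv, max_eq_left (h.d_le.trans hr)]
        linarith [(abs_le.1 h1).1, hH.le_lam, hH.pos]
    rw [h.θ_zero, sub_zero, sub_zero, show 1 / (8 * δ) * δ = 1 / 8 by field_simp] at this
    linarith
  rcases ht.1.eq_or_lt with rfl | h0
  · exact hθδ
  · exact (stay δ ⟨hδ.le, hδH⟩ hθδ t ⟨h0, ht.2⟩).le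

theorem short_div_le_r {t : ℝ} (ht : t ∈ Icc δ H) : t / 16 ≤ r t := by
  have hδ := h.δ_pos
  have h1 := mul_le_sub_of_le_deriv (c := 1 / 16) ht.1
    (fun u hu => h.hasDerivAt_r u ⟨hδ.le.trans hu.1, hu.2.trans (ht.2.trans hHS)⟩) fun u hu =>
      one_div_sixteen_le_sin (h.short_eighth_le_θ hm hH hHS hδH ⟨hu.1, hu.2.trans ht.2⟩)
        (h.short_θ_le hm hH hHS hδH ⟨hδ.le.trans hu.1, hu.2.trans ht.2⟩)
  have h2 := h.short_le_r hm hH hHS hδH ⟨hδ.le, hδH⟩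
  linarith

/-- The reverse comparison: the derivative of `r ^ m * cos θ` is at most `-(lam / 2) * r ^ m * sin
θ`. With `c = lam / (2 * (m + 1))` integration yields `r cos θ ≤ 2δ - c r²`, and `r ≥ t / 16` turns
this into a bound in `t`. -/
theorem short_cos_θ_le {t : ℝ} (ht : t ∈ Icc δ H) :
    cos (θ t) ≤ 32 * δ / t - lam / (2 * (m + 1)) * t / 16 := by
  have hδ := h.δ_pos
  have hl : 0 < lam := by linarith [hH.pos, hH.le_lam]
  have hsub : ∀ u ∈ Icc 0 t, u ∈ Icc 0 H := fun u hu => ⟨hu.1, hu.2.trans ht.2⟩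
  have hsubS : ∀ u ∈ Icc 0 t, u ∈ Icc 0 S := fun u hu => ⟨hu.1, (hsub u hu).2.trans hHS⟩
  have ht0 : 0 < t := hδ.trans_le ht.1
  have key := sub_le_sub_of_deriv_le ht0.le
    (fun u hu => h.hasDerivAt_pow_mul_cos hm (hsubS u hu) (h.short_le_r hm hH hHS hδH (hsub u hu)))
    (fun u hu => h.hasDerivAt_pow_succ (-(lam / (2 * (m + 1)))) (hsubS u hu)) fun u hu => by
      obtain ⟨h1, h2, -⟩ := h.short_bounds hm hH hHS hδH (hsub u hu)
      have hr0 : 0 < r u := hδ.trans_le (h.short_le_r hm hH hHS hδH (hsub u hu))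
      have h3 := sin_nonneg_of_nonneg_of_le_pi (h.short_θ_nonneg hm hH hHS hδH (hsub u hu))
        (by linarith [h.short_θ_le hm hH hHS hδH (hsub u hu), pi_pos])
      have h5 : 0 ≤ r u ^ m * sin (θ u) := mul_nonneg (pow_pos hr0 m).le h3
      have h6 : lam / 2 ≤ lam + x u * sin (θ u) - r u * cos (θ u) := by
        nlinarith [(abs_le.1 h1).1, cos_le_one (θ u), hH.le_lam]
      have h7 : -(lam / (2 * (m + 1))) * ((m : ℝ) + 1) = -(lam / 2) := by
        field_simp
      rw [h7]
      nlinarith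
  rw [h.θ_zero, cos_zero, h.r_zero] at key
  have hc : 0 < lam / (2 * ((m : ℝ) + 1)) := by positivity
  have hcδ : lam / (2 * ((m : ℝ) + 1)) * δ ≤ 1 := by
    have h1 : lam / (2 * ((m : ℝ) + 1)) ≤ lam := div_le_self hl.le (by
      have : (0 : ℝ) ≤ m := Nat.cast_nonneg _
      linarith)
    nlinarith [hH.mul_le]
  set c := lam / (2 * ((m : ℝ) + 1))
  have htH : t ∈ Icc 0 H := ⟨ht0.le, ht.2⟩
  have hrδ := h.short_le_r hm hH hHS hδH htH
  have hr0 : 0 < r t := hδ.trans_le hrδ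
  have h1 : r t * cos (θ t) ≤ 2 * δ - c * r t ^ 2 := by
    obtain ⟨k, rfl⟩ : ∃ k, m = k + 1 := ⟨m - 1, by omega⟩
    have hk := pow_pos hr0 k
    have hle : δ ^ k ≤ r t ^ k := pow_le_pow_left₀ hδ.le hrδ k
    have e : δ ^ (k + 1) * 1 + c * δ ^ (k + 1 + 1) = δ ^ k * (δ * (1 + c * δ)) := by ring
    have h2 : δ ^ k * (δ * (1 + c * δ)) ≤ r t ^ k * (2 * δ) :=
      mul_le_mul hle (by nlinarith) (by positivity) hk.le
    have h3 : r t ^ k * (r t * cos (θ t)) ≤ r t ^ k * (2 * δ - c * r t ^ 2) := by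
      have e2 : r t ^ k * (r t * cos (θ t)) = r t ^ (k + 1) * cos (θ t) := by ring
      have e3 : r t ^ k * (2 * δ - c * r t ^ 2) = r t ^ k * (2 * δ) - c * r t ^ (k + 1 + 1) := by
        ring
      rw [e2, e3]
      linarith
    exact le_of_mul_le_mul_left h3 hk
  have hrt := h.short_div_le_r hm hH hHS hδH ht
  have h2 : cos (θ t) ≤ 2 * δ / r t - c * r t := by
    rw [← mul_le_mul_iff_right₀ hr0]
    refine h1.trans_eq ?_
    field_simp
  have h3 : 2 * δ / r t ≤ 32 * δ / t := by
    rw [div_le_div_iff₀ hr0 ht0]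
    nlinarith
  have h4 : c * (t / 16) ≤ c * r t := mul_le_mul_of_nonneg_left hrt hc.le
  linarith [mul_div_assoc c t 16]

end IsShot

theorem exists_small_height {lam : ℝ} (hm : 1 ≤ m) (hlam : 0 < lam) :
    ∃ δ, 0 < δ ∧ δ ≤ 1 ∧ ∀ (d S : ℝ) (x r θ : ℝ → ℝ), 1 ≤ S → IsShot m lam d δ S x r θ →
      ∃ s, 0 < s ∧ s < S ∧ x s < 0 ∧ ∀ t ∈ Icc 0 s,
        θ t < π ∧ (0 < profileCurv m lam d (x t) (r t) (θ t) ∨ π / 2 < θ t) := by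
  obtain ⟨H, hH⟩ := exists_isShortTime hlam
  have hH0 := hH.pos
  have hH1 := hH.le_eighth
  obtain ⟨c, hc⟩ : ∃ c, c = lam / (2 * ((m : ℝ) + 1)) := ⟨_, rfl⟩
  have hc0 : 0 < c := by rw [hc]; positivity
  -- The height will be `σ²`: up to time `σ` the curve moves by at most `σ`, and from then on `32 *
  -- σ² / t ≤ 32 * σ`. The last condition lets the negative term `-c * H² / 32` of the integrated
  -- bound dominate at time `H`.
  obtain ⟨σ, hσ0, hσH, hσc⟩ : ∃ σ, 0 < σ ∧ σ ≤ H ∧ σ * (33 + c) ≤ c * H ^ 2 / 64 := by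
    refine ⟨min H (c * H ^ 2 / 64 / (33 + c)), by positivity, min_le_left _ _, ?_⟩
    rw [← le_div_iff₀ (by positivity)]
    exact min_le_right _ _
  have hσσ : σ ^ 2 ≤ σ := by nlinarith
  have hδH : σ ^ 2 ≤ H := hσσ.trans hσH
  refine ⟨σ ^ 2, by positivity, by nlinarith, fun d S x r θ hS h => ?_⟩
  have hHS : H ≤ S := by linarith
  refine ⟨H, hH0, by linarith, ?_, fun t ht => ⟨?_, ?_⟩⟩
  · have hd : ∀ u ∈ Icc σ H,
        HasDerivAt (fun t => 32 * σ * t - c / 32 * t ^ 2) (32 * σ - c * u / 16) u := by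
      intro u _
      refine (((hasDerivAt_id u).const_mul (32 * σ)).sub
        (((hasDerivAt_id u).pow 2).const_mul (c / 32))).congr_deriv ?_
      simp only [id]; ring
    have h1 := sub_le_sub_of_deriv_le hσH
      (fun u hu => h.hasDerivAt_x u ⟨hσ0.le.trans hu.1, hu.2.trans hHS⟩) hd fun u hu => by
        have hu0 : 0 < u := hσ0.trans_le hu.1
        refine (h.short_cos_θ_le hm hH hHS hδH ⟨hσσ.trans hu.1, hu.2⟩).trans ?_
        rw [← hc]
        have : 32 * σ ^ 2 / u ≤ 32 * σ := by
          rw [div_le_iff₀ hu0]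
          nlinarith [hu.1]
        linarith
    have h2 := (abs_le.1 (h.abs_x_le ⟨hσ0.le, hσH.trans hHS⟩)).2
    nlinarith
  · linarith [h.short_θ_le hm hH hHS hδH ht, pi_pos]
  · rcases le_or_gt (θ t) (π / 2) with hle | hlt
    · refine Or.inl (h.short_curv_pos hm hH hHS hδH ht (cos_nonneg_of_mem_Icc ⟨?_, hle⟩))
      linarith [h.short_θ_nonneg hm hH hHS hδH ht, pi_pos]
    · exact Or.inr hlt

end SmallHeight

/-! ### Compactness, openness and the extremal shot. -/

section Closing

open Set Real Filter Topology

variable {m : ℕ} {lam d K : ℝ}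

theorem continuous_profileCurv (m : ℕ) (lam : ℝ) (hd : 0 < d) :
    Continuous fun p : ℝ × ℝ × ℝ => profileCurv m lam d p.1 p.2.1 p.2.2 := by
  unfold profileCurv
  have : ∀ p : ℝ × ℝ × ℝ, max p.2.1 d ≠ 0 := fun p => (hd.trans_le (le_max_right _ _)).ne'
  fun_prop (disch := exact this _)

theorem hasDerivAt_components {m : ℕ} {lam d K : ℝ} {f : ℝ → ℝ × ℝ × ℝ} {t : ℝ}
    (hf : HasDerivAt f (profileField m lam d K (f t)) t) :
    HasDerivAt (fun t => (f t).1) (cos (f t).2.2) t ∧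
    HasDerivAt (fun t => (f t).2.1) (sin (f t).2.2) t ∧
    HasDerivAt (fun t => (f t).2.2) (profileField m lam d K (f t)).2.2 t :=
  ⟨hf.fst, hf.snd.fst, hf.snd.snd⟩

theorem profileField_angle_eq {p : ℝ × ℝ × ℝ} (h1 : |p.1| ≤ K) (h2 : |p.2.1| ≤ K) :
    (profileField m lam d K p).2.2 = profileCurv m lam d p.1 p.2.1 p.2.2 := by
  simp only [profileField, profileCurv, clip_eq_self h1, clip_eq_self h2]

theorem profileField_solution_bounds {f : ℝ → ℝ × ℝ × ℝ} {δ S : ℝ} (hδ : 0 < δ)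
    (hK : δ + S ≤ K) (hf0 : f 0 = (0, δ, 0))
    (hf : ∀ t, HasDerivAt f (profileField m lam d K (f t)) t) {t : ℝ} (ht : t ∈ Icc 0 S) :
    |(f t).1| ≤ K ∧ |(f t).2.1| ≤ K := by
  have hx := fun u (_ : u ∈ Icc 0 t) => (hasDerivAt_components (hf u)).1
  have hr := fun u (_ : u ∈ Icc 0 t) => (hasDerivAt_components (hf u)).2.1
  have h1 := sub_le_mul_of_deriv_le ht.1 hx fun u _ => cos_le_one _
  have h2 := mul_le_sub_of_le_deriv ht.1 hx fun u _ => neg_one_le_cos _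
  have h3 := sub_le_mul_of_deriv_le ht.1 hr fun u _ => sin_le_one _
  have h4 := mul_le_sub_of_le_deriv ht.1 hr fun u _ => neg_one_le_sin _
  simp only [hf0] at h1 h2 h3 h4
  exact ⟨abs_le.2 ⟨by linarith [ht.2], by linarith [ht.2]⟩,
    abs_le.2 ⟨by linarith [ht.2], by linarith [ht.2]⟩⟩

theorem isShot_of_profileField {f : ℝ → ℝ × ℝ × ℝ} {δ S : ℝ} (hd : 0 < d) (hdδ : d ≤ δ)
    (hK : δ + S ≤ K) (hf0 : f 0 = (0, δ, 0))
    (hf : ∀ t, HasDerivAt f (profileField m lam d K (f t)) t) :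
    IsShot m lam d δ S (fun t => (f t).1) (fun t => (f t).2.1) (fun t => (f t).2.2) where
  d_pos := hd
  d_le := hdδ
  x_zero := by simp [hf0]
  r_zero := by simp [hf0]
  θ_zero := by simp [hf0]
  hasDerivAt_x := fun t _ => (hasDerivAt_components (hf t)).1
  hasDerivAt_r := fun t _ => (hasDerivAt_components (hf t)).2.1
  hasDerivAt_θ := fun t ht => by
    obtain ⟨h1, h2⟩ := profileField_solution_bounds (hd.trans_le hdδ) hK hf0 hf ht
    rw [← profileField_angle_eq h1 h2]
    exact (hasDerivAt_components (hf t)).2.2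

/-- Where `sin θ = 0` the field does not depend on `x`, so if the angular component also vanishes,
the horizontal line through the point is an integral curve. Uniqueness does the rest. -/
theorem angle_eq_of_horizontal {f : ℝ → ℝ × ℝ × ℝ} (hd : 0 < d) (hK : 0 ≤ K)
    (hf : ∀ t, HasDerivAt f (profileField m lam d K (f t)) t) {t : ℝ} (hs : sin (f t).2.2 = 0)
    (hc : (profileField m lam d K (f t)).2.2 = 0) (u : ℝ) : (f u).2.2 = (f t).2.2 := by
  obtain ⟨C, -, hC, -⟩ := exists_lipschitzWith_profileField m lam hd hK
  let g : ℝ → ℝ × ℝ × ℝ := fun u => ((f t).1 + (u - t) * cos (f t).2.2, (f t).2.1, (f t).2.2)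
  have hg : ∀ u, HasDerivAt g (profileField m lam d K (g u)) u := by
    intro u
    have e : profileField m lam d K (g u) = (cos (f t).2.2, 0, 0) := by
      simp only [profileField, hs, mul_zero] at hc
      simp only [profileField, g, hs, mul_zero, hc]
    rw [e]
    refine HasDerivAt.prodMk ?_ ((hasDerivAt_const u _).prodMk (hasDerivAt_const u _))
    simpa using (((hasDerivAt_id u).sub_const t).mul_const (cos (f t).2.2)).const_add (f t).1
  have := solution_unique hC hf hg (t₀ := t) (by simp [g])
  rw [this]

/-- If the curvature of a profile curve vanishes at a point, then its derivative is
`-m sin θ cos θ / r²` there. -/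
theorem IsShot.hasDerivAt_curv {δ S t : ℝ} {x r θ : ℝ → ℝ} (h : IsShot m lam d δ S x r θ)
    (ht : t ∈ Icc 0 S) (hr : d < r t) (hk : profileCurv m lam d (x t) (r t) (θ t) = 0) :
    HasDerivAt (fun t => profileCurv m lam d (x t) (r t) (θ t))
      (-(m * sin (θ t) * cos (θ t) / r t ^ 2)) t := by
  have h1 := h.hasDerivAt_x t ht
  have h2 := h.hasDerivAt_r t ht
  have h3 := h.hasDerivAt_θ t ht
  rw [hk] at h3
  have hr0 : 0 < r t := h.d_pos.trans hr
  have hev : ∀ᶠ u in 𝓝 t, d < r u := h2.continuousAt.eventually (lt_mem_nhds hr)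
  have hD := ((h1.mul h3.sin).const_add lam).add
    ((((hasDerivAt_const t (m : ℝ)).div h2 hr0.ne').sub h2).mul h3.cos)
  refine (hD.congr_deriv ?_).congr_of_eventuallyEq ?_
  · simp only [Pi.sub_apply, Pi.div_apply]
    field_simp
    ring
  · filter_upwards [hev] with u hu
    simp [profileCurv, max_eq_left hu.le, add_assoc]

/-- A time `s` until which the shot `f` satisfies the closed conditions met by all profile curves
returning to the axis before the angle `π` is reached. -/
structure IsWeakReturn (m : ℕ) (lam d : ℝ) (f : ℝ → ℝ × ℝ × ℝ) (s : ℝ) : Prop where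
  x_eq : (f s).1 = 0
  le_θ : π / 2 ≤ (f s).2.2
  θ_nonneg : ∀ t ∈ Icc 0 s, 0 ≤ (f t).2.2
  θ_le : ∀ t ∈ Icc 0 s, (f t).2.2 ≤ π
  x_nonneg : ∀ t ∈ Icc 0 s, 0 ≤ (f t).1
  curv : ∀ t ∈ Icc 0 s, 0 ≤ profileCurv m lam d (f t).1 (f t).2.1 (f t).2.2 ∨ π / 2 ≤ (f t).2.2

/-- Equality in the closed conditions is excluded. This keeps limits of returning shots, and hence
the extremal one, nondegenerate. -/
theorem IsWeakReturn.exists_isTurn {f : ℝ → ℝ × ℝ × ℝ} {δ S s : ℝ} (hlam : 0 < lam)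
    (hm : 1 ≤ m) (hd : 0 < d) (hdδ : d < δ) (hK : δ + S ≤ K) (hf0 : f 0 = (0, δ, 0))
    (hf : ∀ t, HasDerivAt f (profileField m lam d K (f t)) t) (hs0 : 0 ≤ s) (hsS : s ≤ S)
    (hw : IsWeakReturn m lam d f s) :
    ∃ s₁, IsTurn m lam d (fun t => (f t).1) (fun t => (f t).2.1) (fun t => (f t).2.2) s₁ s := by
  have h := isShot_of_profileField hd hdδ.le hK hf0 hf
  have hπ := pi_pos
  have hS : ∀ t ∈ Icc 0 s, t ∈ Icc 0 S := fun t ht => ⟨ht.1, ht.2.trans hsS⟩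
  have hs : 0 < s := by
    refine lt_of_le_of_ne hs0 ?_
    rintro rfl
    have := hw.le_θ
    simp only [hf0] at this
    linarith
  have hnot : ∀ t ∈ Icc 0 s, sin (f t).2.2 = 0 →
      profileCurv m lam d (f t).1 (f t).2.1 (f t).2.2 ≠ 0 := by
    intro t ht hsin hk
    obtain ⟨h1, h2⟩ := profileField_solution_bounds (hd.trans hdδ) hK hf0 hf (hS t ht)
    rw [← profileField_angle_eq h1 h2] at hk
    have hK0 : 0 ≤ K := (abs_nonneg _).trans h1
    have e0 := angle_eq_of_horizontal hd hK0 hf hsin hk 0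
    have e1 := angle_eq_of_horizontal hd hK0 hf hsin hk s
    simp only [hf0] at e0
    have := hw.le_θ
    linarith
  refine h.exists_isTurn hs hsS (fun t ht => ?_) (fun t ht => ?_) hw.x_eq.le
  · by_contra! hcon
    obtain ⟨hk, hθ⟩ := hcon
    have hθlt : (f t).2.2 < π / 2 := by
      -- At `θ = π / 2` the curvature is `lam + x`, which is positive.
      refine lt_of_le_of_ne hθ fun heq => ?_
      rw [heq, profileCurv, sin_pi_div_two, cos_pi_div_two] at hk
      linarith [hw.x_nonneg t ht]
    have hk0 : profileCurv m lam d (f t).1 (f t).2.1 (f t).2.2 = 0 :=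
      le_antisymm hk ((hw.curv t ht).resolve_right hθlt.not_ge)
    have hcos : 0 < cos (f t).2.2 := cos_pos_of_mem_Ioo ⟨by linarith [hw.θ_nonneg t ht], hθlt⟩
    refine hnot t ht ?_ hk0
    rcases ht.1.eq_or_lt with rfl | ht0
    · simp [hf0]
    have hts : t < s := lt_of_le_of_ne ht.2 (by rintro rfl; linarith [hw.le_θ])
    have hr : δ ≤ (f t).2.1 := h.le_r (hS t ht) fun u hu =>
      ⟨hw.θ_nonneg u ⟨hu.1, hu.2.trans ht.2⟩, hw.θ_le u ⟨hu.1, hu.2.trans ht.2⟩⟩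
    -- A zero of the curvature in the phase `θ < π / 2` is a minimum. The derivative `-m sin θ cos θ
    -- / r²` must vanish there, hence `sin θ = 0`, which `hnot` forbids.
    have hmin : IsLocalMin (fun t => profileCurv m lam d (f t).1 (f t).2.1 (f t).2.2) t := by
      have hc : ContinuousAt (fun t => (f t).2.2) t :=
        (hasDerivAt_components (hf t)).2.2.continuousAt
      filter_upwards [Ioo_mem_nhds ht0 hts, hc.eventually (gt_mem_nhds hθlt)] with u hu hu'
      rw [hk0]
      exact (hw.curv u ⟨hu.1.le, hu.2.le⟩).resolve_right hu'.not_ge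
    have hz := hmin.hasDerivAt_eq_zero (h.hasDerivAt_curv (hS t ht) (hdδ.trans_le hr) hk0)
    have hm0 : (m : ℝ) ≠ 0 := by positivity
    have hr0 : (f t).2.1 ≠ 0 := (hd.trans (hdδ.trans_le hr)).ne'
    rw [neg_eq_zero, div_eq_zero_iff] at hz
    rcases hz with hz | hz
    · rcases mul_eq_zero.1 hz with hz | hz
      · exact (mul_eq_zero.1 hz).resolve_left hm0
      · exact absurd hz hcos.ne'
    · exact absurd hz (pow_ne_zero 2 hr0)
  · have ht' := Ico_subset_Icc_self ht
    refine lt_of_le_of_ne (hw.θ_le t ht') fun heq => ?_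
    have ht0 : 0 < t := lt_of_le_of_ne ht.1 (by rintro rfl; simp only [hf0] at heq; linarith)
    -- Touching `π` before the end would be a maximum of `θ`, so the curvature would vanish at a
    -- horizontal tangent.
    have hmax : IsLocalMax (fun t => (f t).2.2) t := by
      filter_upwards [Ioo_mem_nhds ht0 ht.2] with u hu
      rw [heq]
      exact hw.θ_le u ⟨hu.1.le, hu.2.le⟩
    exact hnot t ht' (by rw [heq, sin_pi]) (hmax.hasDerivAt_eq_zero (h.hasDerivAt_θ t (hS t ht')))

/-- Positive curvature at the start reads `lam + m / δ - δ > 0`, which bounds `δ`. After the turn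
`x` goes from positive to negative; its zero is the return, and the duration bound applies to it. -/
theorem exists_isWeakReturn {f : ℝ → ℝ × ℝ × ℝ} {δ S s : ℝ} (hlam : 0 < lam)
    (hd : 0 < d) (hdδ : d ≤ δ) (hK : δ + S ≤ K) (hf0 : f 0 = (0, δ, 0))
    (hf : ∀ t, HasDerivAt f (profileField m lam d K (f t)) t) (hs0 : 0 < s) (hsS : s ≤ S)
    (hx : (f s).1 < 0) (hA : ∀ t ∈ Icc 0 s, (f t).2.2 < π ∧
      (0 < profileCurv m lam d (f t).1 (f t).2.1 (f t).2.2 ∨ π / 2 < (f t).2.2)) :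
    δ ≤ lam + m + 1 ∧ ∃ s' ∈ Icc 0 (returnTimeBound m lam (lam + m + 1)),
      IsWeakReturn m lam d f s' := by
  have h := isShot_of_profileField hd hdδ hK hf0 hf
  obtain ⟨s₁, hT⟩ := h.exists_isTurn hs0 hsS (fun t ht => (hA t ht).2)
    (fun t ht => (hA t (Ico_subset_Icc_self ht)).1) hx.le
  have hδ : δ ≤ lam + m + 1 := by
    have := hT.curv_pos 0 ⟨le_rfl, hT.pos.le⟩
    simp only [hf0, profileCurv, sin_zero, cos_zero, max_eq_left hdδ] at this
    by_contra! hlt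
    have hm0 : (0 : ℝ) ≤ m := Nat.cast_nonneg _
    have h1 : (m : ℝ) / δ ≤ m := div_le_self hm0 (by linarith)
    linarith
  have hx₁ : 0 < (f s₁).1 := by
    have := h.x_strictMonoOn hT hsS ⟨le_rfl, hT.pos.le⟩ ⟨hT.pos.le, le_rfl⟩ hT.pos
    simpa [hf0] using this
  obtain ⟨s', hs', hxs'⟩ := intermediate_value_Icc' hT.lt.le
    (f := fun t => (f t).1)
    (fun t _ => (hasDerivAt_components (hf t)).1.continuousAt.continuousWithinAt)
    (show (0 : ℝ) ∈ Icc (f s).1 (f s₁).1 from ⟨hx.le, hx₁.le⟩)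
  have hs₁' : s₁ < s' := lt_of_le_of_ne hs'.1 (by rintro rfl; exact hx₁.ne' hxs')
  have hT' := hT.mono_right hs₁' hs'.2
  have hs'S := hs'.2.trans hsS
  refine ⟨hδ, s', ⟨hT'.s_pos.le, h.duration_le hT' hs'S hxs'.ge hlam hδ hxs'⟩, hxs',
    hT'.upper s' ⟨hs'.1, le_rfl⟩, fun t ht => (h.θ_mem hT' ht).1, fun t ht => (h.θ_mem hT' ht).2,
    fun t ht => h.x_nonneg hT' hs'S hxs'.ge ht, fun t ht => ?_⟩
  exact (hA t ⟨ht.1, ht.2.trans hs'.2⟩).2.imp le_of_lt le_of_lt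

theorem isCompact_isWeakReturn {γ : ℝ → ℝ → ℝ × ℝ × ℝ} (hd : 0 < d)
    (hγ : ContinuousOn (fun q : ℝ × ℝ => γ q.1 q.2) {q | 0 ≤ q.2}) (a b c : ℝ) :
    IsCompact {q : ℝ × ℝ | q ∈ Icc a b ×ˢ Icc 0 c ∧ IsWeakReturn m lam d (γ q.1) q.2} := by
  -- Writing times in `[0, s]` as `u * s` with `u ∈ [0, 1]` removes the moving endpoint: the
  -- conditions become an intersection, over a fixed index set, of closed conditions on `(δ, s)`.
  let Φ : ℝ → ℝ × ℝ → ℝ × ℝ × ℝ := fun u q => γ q.1 (max (u * q.2) 0)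
  have hΦ : ∀ u, Continuous (Φ u) := fun u =>
    hγ.comp_continuous (f := fun q : ℝ × ℝ => (q.1, max (u * q.2) 0)) (by fun_prop)
      fun q => le_max_right (_ : ℝ) 0
  have hκ := continuous_profileCurv m lam hd
  have h1 : ∀ u, Continuous fun q => (Φ u q).1 := fun u => continuous_fst.comp (hΦ u)
  have h3 : ∀ u, Continuous fun q => (Φ u q).2.2 := fun u =>
    continuous_snd.comp (continuous_snd.comp (hΦ u))
  have hk : ∀ u, Continuous fun q => profileCurv m lam d (Φ u q).1 (Φ u q).2.1 (Φ u q).2.2 :=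
    fun u => hκ.comp (hΦ u)
  let Z : Set (ℝ × ℝ) := {q | (Φ 1 q).1 = 0 ∧ π / 2 ≤ (Φ 1 q).2.2} ∩
    ⋂ u ∈ Icc (0 : ℝ) 1, {q | 0 ≤ (Φ u q).2.2 ∧ (Φ u q).2.2 ≤ π ∧ 0 ≤ (Φ u q).1 ∧
      (0 ≤ profileCurv m lam d (Φ u q).1 (Φ u q).2.1 (Φ u q).2.2 ∨ π / 2 ≤ (Φ u q).2.2)}
  have hZ : IsClosed Z := by
    refine ((isClosed_eq (h1 1) continuous_const).inter
      (isClosed_le continuous_const (h3 1))).inter (isClosed_biInter fun u _ => ?_)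
    exact (isClosed_le continuous_const (h3 u)).inter ((isClosed_le (h3 u) continuous_const).inter
      ((isClosed_le continuous_const (h1 u)).inter
        ((isClosed_le continuous_const (hk u)).union (isClosed_le continuous_const (h3 u)))))
  have heq : {q : ℝ × ℝ | q ∈ Icc a b ×ˢ Icc 0 c ∧ IsWeakReturn m lam d (γ q.1) q.2} =
      (Icc a b ×ˢ Icc 0 c) ∩ Z := by
    ext ⟨δ, s⟩
    refine and_congr_right fun hq => ?_
    have hs0 : 0 ≤ s := hq.2.1
    have e : ∀ u ∈ Icc (0 : ℝ) 1, Φ u (δ, s) = γ δ (u * s) := fun u hu => by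
      simp only [Φ]
      rw [max_eq_left (mul_nonneg hu.1 hs0)]
    have e1 : Φ 1 (δ, s) = γ δ s := by rw [e 1 ⟨zero_le_one, le_rfl⟩, one_mul]
    have hmem : ∀ u ∈ Icc (0 : ℝ) 1, u * s ∈ Icc 0 s := fun u hu =>
      ⟨mul_nonneg hu.1 hs0, mul_le_of_le_one_left hs0 hu.2⟩
    have hrep : ∀ t ∈ Icc 0 s, ∃ u ∈ Icc (0 : ℝ) 1, u * s = t := by
      intro t ht
      rcases hs0.eq_or_lt with h0 | h0
      · exact ⟨0, ⟨le_rfl, zero_le_one⟩, by linarith [ht.1, ht.2]⟩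
      · exact ⟨t / s, ⟨div_nonneg ht.1 hs0, div_le_one_of_le₀ ht.2 hs0⟩, div_mul_cancel₀ _ h0.ne'⟩
    constructor
    · intro hw
      refine ⟨by simpa only [mem_ofPred_eq, e1] using ⟨hw.x_eq, hw.le_θ⟩, mem_iInter₂.2 fun u hu => ?_⟩
      simp only [mem_ofPred_eq, e u hu]
      exact ⟨hw.θ_nonneg _ (hmem u hu), hw.θ_le _ (hmem u hu), hw.x_nonneg _ (hmem u hu),
        hw.curv _ (hmem u hu)⟩
    · rintro ⟨hz1, hz2⟩
      simp only [mem_ofPred_eq, e1] at hz1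
      have hz : ∀ t ∈ Icc 0 s, 0 ≤ (γ δ t).2.2 ∧ (γ δ t).2.2 ≤ π ∧ 0 ≤ (γ δ t).1 ∧
          (0 ≤ profileCurv m lam d (γ δ t).1 (γ δ t).2.1 (γ δ t).2.2 ∨ π / 2 ≤ (γ δ t).2.2) := by
        intro t ht
        obtain ⟨u, hu, rfl⟩ := hrep t ht
        have := mem_iInter₂.1 hz2 u hu
        simpa only [mem_ofPred_eq, e u hu] using this
      exact ⟨hz1.1, hz1.2, fun t ht => (hz t ht).1, fun t ht => (hz t ht).2.1,
        fun t ht => (hz t ht).2.2.1, fun t ht => (hz t ht).2.2.2⟩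
  rw [heq]
  exact (isCompact_Icc.prod isCompact_Icc).inter_right hZ

/-- If a profile curve returns to the axis before the angle `π` is reached, then so do the profile
curves shot from slightly higher points. -/
theorem exists_higher_return {γ : ℝ → ℝ → ℝ × ℝ × ℝ} {δ S s s₁ : ℝ} (hd : 0 < d)
    (hdδ : d ≤ δ) (hK : δ + S ≤ K) (hγ0 : ∀ δ, γ δ 0 = (0, δ, 0))
    (hγ : ∀ δ t, HasDerivAt (γ δ) (profileField m lam d K (γ δ t)) t)
    (hc : ContinuousOn (fun q : ℝ × ℝ => γ q.1 q.2) {q | 0 ≤ q.2}) (hsS : s < S)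
    (hT : IsTurn m lam d (fun t => (γ δ t).1) (fun t => (γ δ t).2.1) (fun t => (γ δ t).2.2) s₁ s)
    (hx : (γ δ s).1 = 0) (hθ : (γ δ s).2.2 < π) {b : ℝ} (hb : δ < b) :
    ∃ δ' ∈ Ioo δ b, ∃ s' ∈ Ioo 0 S, (γ δ' s').1 < 0 ∧ ∀ t ∈ Icc 0 s', (γ δ' t).2.2 < π ∧
      (0 < profileCurv m lam d (γ δ' t).1 (γ δ' t).2.1 (γ δ' t).2.2 ∨ π / 2 < (γ δ' t).2.2) := by
  have h := isShot_of_profileField hd hdδ hK (hγ0 δ) (hγ δ)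
  have hs0 := hT.s_pos
  -- Along the returning arc the state stays in this open set. Since `x' = cos θ < 0` at the return,
  -- the arc can be prolonged inside `O` until `x < 0`.
  let O : Set (ℝ × ℝ × ℝ) := {p | p.2.2 < π ∧ (0 < profileCurv m lam d p.1 p.2.1 p.2.2 ∨ π / 2 < p.2.2)}
  have h3 : Continuous fun p : ℝ × ℝ × ℝ => p.2.2 := by fun_prop
  have hO : IsOpen O :=
    (isOpen_lt h3 continuous_const).inter
      ((isOpen_lt continuous_const (continuous_profileCurv m lam hd)).union
        (isOpen_lt continuous_const h3))
  have hsO : ∀ t ∈ Icc 0 s, γ δ t ∈ O := by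
    intro t ht
    refine ⟨?_, ?_⟩
    · rcases ht.2.eq_or_lt with rfl | hts
      · exact hθ
      · exact hT.θ_lt_pi t ⟨ht.1, hts⟩
    · rcases le_or_gt t s₁ with h1 | h1
      · exact Or.inl (hT.curv_pos t ⟨ht.1, h1⟩)
      · exact Or.inr (hT.lt_θ t ⟨h1, ht.2⟩)
  have hγc : ContinuousAt (γ δ) s := (hγ δ s).continuousAt
  obtain ⟨ε, hε, hεO⟩ := Metric.mem_nhds_iff.1 (hγc.preimage_mem_nhds
    (hO.mem_nhds (hsO s ⟨hs0.le, le_rfl⟩)))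
  have hcos : cos (γ δ s).2.2 < 0 :=
    cos_neg_of_pi_div_two_lt_of_lt (hT.lt_θ s ⟨hT.lt, le_rfl⟩) (by linarith [pi_pos])
  have hneg : ∀ᶠ u in 𝓝[>] s, (γ δ u).1 < 0 := by
    have := (hasDerivAt_iff_tendsto_slope.1 (hasDerivAt_components (hγ δ s)).1).eventually
      (gt_mem_nhds hcos)
    filter_upwards [this.filter_mono (nhdsWithin_mono s fun u (hu : s < u) => hu.ne'),
      self_mem_nhdsWithin] with u hu hsu
    have hsu : s < u := hsu
    rw [slope_def_field, hx, div_neg_iff] at hu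
    rcases hu with hu | hu <;> linarith [hu.1, hu.2]
  obtain ⟨s', hs'x, hs'⟩ := (hneg.and (Ioo_mem_nhdsGT
    (show s < min (s + ε) S from lt_min (by linarith) hsS))).exists
  have hs'0 : 0 < s' := hs0.trans hs'.1
  have hs'O : ∀ t ∈ Icc 0 s', γ δ t ∈ O := by
    intro t ht
    rcases le_total t s with h1 | h1
    · exact hsO t ⟨ht.1, h1⟩
    · refine hεO ?_
      rw [Metric.mem_ball, Real.dist_eq, abs_of_nonneg (by linarith)]
      linarith [hs'.2.trans_le (min_le_left _ _), ht.2]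
  let Φ : ℝ × ℝ → ℝ × ℝ × ℝ := fun q => γ q.1 (max q.2 0)
  have hΦ : Continuous Φ :=
    hc.comp_continuous (f := fun q : ℝ × ℝ => (q.1, max q.2 0)) (by fun_prop)
      fun q => le_max_right (_ : ℝ) 0
  -- Compactness of the time interval makes the neighbourhood of `δ` uniform in time.
  have hev1 : ∀ᶠ δ' in 𝓝 δ, ∀ t ∈ Icc 0 s', Φ (δ', t) ∈ O := by
    refine isCompact_Icc.eventually_forall_of_forall_eventually fun t ht => ?_
    refine hΦ.continuousAt.preimage_mem_nhds (hO.mem_nhds ?_)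
    simpa only [Φ, max_eq_left ht.1] using hs'O t ht
  have hev2 : ∀ᶠ δ' in 𝓝 δ, (Φ (δ', s')).1 < 0 := by
    have hcont : Continuous fun δ' => (Φ (δ', s')).1 := by fun_prop
    refine hcont.continuousAt.eventually (gt_mem_nhds ?_)
    simpa only [Φ, max_eq_left hs'0.le] using hs'x
  obtain ⟨δ', ⟨h1, h2⟩, h3⟩ :=
    (((hev1.and hev2).filter_mono nhdsWithin_le_nhds).and (Ioo_mem_nhdsGT hb)).exists
  refine ⟨δ', h3, s', ⟨hs'0, hs'.2.trans_le (min_le_right _ _)⟩, ?_, fun t ht => ?_⟩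
  · simpa only [Φ, max_eq_left hs'0.le] using h2
  · have := h1 t ht
    rw [show Φ (δ', t) = γ δ' t by simp only [Φ, max_eq_left ht.1]] at this
    exact this

/-- There is a profile curve that returns to the axis horizontally. -/
theorem exists_closing_shot (hm : 1 ≤ m) (hlam : 0 < lam) :
    ∃ (d K δ l s₁ : ℝ) (f : ℝ → ℝ × ℝ × ℝ), 0 < d ∧ d ≤ δ ∧ δ + l ≤ K ∧ f 0 = (0, δ, 0) ∧
      (∀ t, HasDerivAt f (profileField m lam d K (f t)) t) ∧
      IsTurn m lam d (fun t => (f t).1) (fun t => (f t).2.1) (fun t => (f t).2.2) s₁ l ∧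
      (f l).1 = 0 ∧ (f l).2.2 = π := by
  obtain ⟨δ₀, hδ₀, hδ₀1, hsmall⟩ := exists_small_height hm hlam
  set D : ℝ := lam + m + 1 with hD
  set S₀ : ℝ := returnTimeBound m lam D with hS₀
  have hm0 : (0 : ℝ) ≤ m := Nat.cast_nonneg _
  have hD1 : 1 ≤ D := by linarith
  have hS₀0 : 0 ≤ S₀ := by
    have h1 : 0 ≤ D * (exp (π / lam ^ 2 + 1) - 1) :=
      mul_nonneg (by linarith) (sub_nonneg.2 (one_le_exp (by positivity)))
    have h2 : 0 < π / lam := by positivity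
    have h3 := sqrt_nonneg (m : ℝ)
    simp only [hS₀, returnTimeBound]
    linarith
  set S : ℝ := S₀ + 1
  -- The extra `1` leaves room for heights slightly above `D`, and `S = S₀ + 1` for times past the
  -- return. Taking `d` below `δ₀` keeps `max r d` equal to `r` near the curve, as differentiating
  -- the curvature requires.
  set K : ℝ := D + 1 + S with hKdef
  set d : ℝ := δ₀ / 2 with hd_def
  have hd : 0 < d := by positivity
  have hK0 : 0 ≤ K := by positivity
  obtain ⟨C, L, hC, hL⟩ := exists_lipschitzWith_profileField m lam hd hK0
  choose γ hγ0 hγ using fun δ : ℝ => exists_solution hC hL (0, δ, 0)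
  have hc : ContinuousOn (fun q : ℝ × ℝ => γ q.1 q.2) {q | 0 ≤ q.2} :=
    continuousOn_solution hC (by simp only [hγ0]; fun_prop) hγ
  have hdδ : ∀ {δ}, δ₀ ≤ δ → d < δ := fun h => by linarith
  have hne : {q : ℝ × ℝ | q ∈ Icc δ₀ D ×ˢ Icc 0 S₀ ∧ IsWeakReturn m lam d (γ q.1) q.2}.Nonempty := by
    have hK1 : δ₀ + S ≤ K := by linarith
    obtain ⟨s, hs0, hsS, hx, hA⟩ := hsmall d S _ _ _ (by linarith)
      (isShot_of_profileField hd (hdδ le_rfl).le hK1 (hγ0 δ₀) (hγ δ₀))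
    obtain ⟨-, s', hs', hw⟩ := exists_isWeakReturn hlam hd (hdδ le_rfl).le hK1 (hγ0 δ₀) (hγ δ₀)
      hs0 hsS.le hx hA
    exact ⟨(δ₀, s'), ⟨⟨⟨le_rfl, by linarith⟩, hs'⟩, hw⟩⟩
  obtain ⟨⟨δ, l⟩, ⟨⟨hδ, hl⟩, hw⟩, hmax⟩ :=
    (isCompact_isWeakReturn hd hc δ₀ D S₀).exists_isMaxOn hne continuous_fst.continuousOn
  simp only at hδ hl hw
  have hKδ : δ + S ≤ K := by linarith [hδ.2]
  have hlS : l < S := by linarith [hl.2]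
  obtain ⟨s₁, hT⟩ := hw.exists_isTurn hlam hm hd (hdδ hδ.1) hKδ (hγ0 δ) (hγ δ) hl.1 hlS.le
  refine ⟨d, K, δ, l, s₁, γ δ, hd, (hdδ hδ.1).le, by linarith, hγ0 δ, hγ δ, hT, hw.x_eq, ?_⟩
  -- An angle below `π` would yield a returning shot at a greater height, still in the compact set
  -- by the a priori bounds.
  by_contra hne
  have hlt : (γ δ l).2.2 < π := lt_of_le_of_ne hT.θ_le_pi hne
  obtain ⟨δ', hδ', s', hs', hx', hA'⟩ := exists_higher_return hd (hdδ hδ.1).le hKδ hγ0 hγ hc hlS hT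
    hw.x_eq hlt (show δ < δ + 1 by linarith)
  have hδ'0 : δ₀ ≤ δ' := hδ.1.trans hδ'.1.le
  obtain ⟨hδ'D, s'', hs'', hw''⟩ := exists_isWeakReturn hlam hd (hdδ hδ'0).le
    (by linarith [hδ'.2, hδ.2]) (hγ0 δ') (hγ δ') hs'.1 hs'.2.le hx' hA'
  have : δ' ≤ δ := hmax (a := (δ', s'')) ⟨⟨⟨hδ'0, hδ'D⟩, hs''⟩, hw''⟩
  linarith [hδ'.1]

end Closing

/-! ### Reflection, periodicity and simplicity of the closed profile. -/

section Profile

open Set Real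

variable {m : ℕ} {lam d K : ℝ}

/-- The map `(x, r, θ) ↦ (-x, r, b - θ)` with time reversed about `a` preserves the truncated field,
because `clip` is odd and `b` acts as a multiple of `2π`. Both curves agree at time `a`. -/
theorem reflect_eq_self {f : ℝ → ℝ × ℝ × ℝ} (hd : 0 < d) (hK : 0 ≤ K)
    (hf : ∀ t, HasDerivAt f (profileField m lam d K (f t)) t) {a b : ℝ} (hc : cos b = 1)
    (hs : sin b = 0) (h1 : (f a).1 = 0) (h2 : 2 * (f a).2.2 = b) (s : ℝ) :
    (f (2 * a - s)).1 = -(f s).1 ∧ (f (2 * a - s)).2.1 = (f s).2.1 ∧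
      (f (2 * a - s)).2.2 = b - (f s).2.2 := by
  obtain ⟨C, -, hC, -⟩ := exists_lipschitzWith_profileField m lam hd hK
  have hrev : ∀ t, HasDerivAt (fun t => f (2 * a - t)) (-profileField m lam d K (f (2 * a - t))) t := by
    intro t
    have := (hf (2 * a - t)).scomp t ((hasDerivAt_id t).const_sub (2 * a))
    simpa [Function.comp_def] using this
  have key := solution_unique hC
    (f := fun t => (-(f (2 * a - t)).1, (f (2 * a - t)).2.1, b - (f (2 * a - t)).2.2)) (g := f)
    (t₀ := a) (fun t => ?_) hf ?_
  · have := congrFun key s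
    simp only [Prod.ext_iff] at this
    refine ⟨by linarith [this.1], this.2.1, by linarith [this.2.2]⟩
  · have h := hrev t
    have e1 : HasDerivAt (fun t => (f (2 * a - t)).1) (-(cos (f (2 * a - t)).2.2)) t := h.fst
    have e2 : HasDerivAt (fun t => (f (2 * a - t)).2.1) (-(sin (f (2 * a - t)).2.2)) t := h.snd.fst
    have e3 : HasDerivAt (fun t => (f (2 * a - t)).2.2)
        (-(profileField m lam d K (f (2 * a - t))).2.2) t := h.snd.snd
    refine (e1.neg.prodMk (e2.prodMk (e3.const_sub b))).congr_deriv ?_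
    simp [profileField, cos_sub, sin_sub, hc, hs, clip_neg hK]
  · simp only [show 2 * a - a = a by ring, Prod.ext_iff]
    exact ⟨by rw [h1, neg_zero], trivial, by linarith⟩

/-- The differential equations of a profile curve with tangent angle `θ`, parametrized by arc
length. -/
structure IsProfileSolution (m : ℕ) (lam : ℝ) (x r θ : ℝ → ℝ) : Prop where
  hasDerivAt_x : ∀ s, HasDerivAt x (cos (θ s)) s
  hasDerivAt_r : ∀ s, HasDerivAt r (sin (θ s)) s
  hasDerivAt_θ : ∀ s, HasDerivAt θ (lam + x s * sin (θ s) + (m / r s - r s) * cos (θ s)) s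

theorem contDiff_of_hasDerivAt {f f' : ℝ → ℝ} {n : ℕ} (hf : ∀ s, HasDerivAt f (f' s) s)
    (h : ContDiff ℝ n f') : ContDiff ℝ (n + 1 : ℕ) f := by
  push_cast
  rw [contDiff_succ_iff_deriv]
  refine ⟨fun s => (hf s).differentiableAt, by simp, ?_⟩
  rwa [show deriv f = f' from funext fun s => (hf s).deriv]

theorem IsProfileSolution.contDiff {x r θ : ℝ → ℝ} (h : IsProfileSolution m lam x r θ)
    (hr : ∀ s, 0 < r s) : ContDiff ℝ ∞ x ∧ ContDiff ℝ ∞ r ∧ ContDiff ℝ ∞ θ := by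
  have key : ∀ n : ℕ, ContDiff ℝ n x ∧ ContDiff ℝ n r ∧ ContDiff ℝ n θ := by
    intro n
    induction n with
    | zero =>
      simp only [Nat.cast_zero, contDiff_zero]
      exact ⟨continuous_iff_continuousAt.2 fun s => (h.hasDerivAt_x s).continuousAt,
        continuous_iff_continuousAt.2 fun s => (h.hasDerivAt_r s).continuousAt,
        continuous_iff_continuousAt.2 fun s => (h.hasDerivAt_θ s).continuousAt⟩
    | succ n ih =>
      obtain ⟨hx, hr', hθ⟩ := ih
      have hdiv : ContDiff ℝ n fun s => (m : ℝ) / r s :=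
        contDiff_const.div hr' fun s => (hr s).ne'
      exact ⟨contDiff_of_hasDerivAt h.hasDerivAt_x hθ.cos,
        contDiff_of_hasDerivAt h.hasDerivAt_r hθ.sin,
        contDiff_of_hasDerivAt h.hasDerivAt_θ
          ((contDiff_const.add (hx.mul hθ.sin)).add ((hdiv.sub hr').mul hθ.cos))⟩
  exact ⟨contDiff_infty.2 fun n => (key n).1, contDiff_infty.2 fun n => (key n).2.1,
    contDiff_infty.2 fun n => (key n).2.2⟩

/-- There is a closed profile curve satisfying the equation of rotational `lam`-hypersurfaces. -/
theorem exists_torusProfile (hm : 1 ≤ m) (hlam : 0 < lam) :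
    ∃ (x r θ : ℝ → ℝ) (l : ℝ), IsTorusProfile x r l ∧ IsProfileSolution m lam x r θ := by
  obtain ⟨d, K, δ, l, s₁, f, hd, hdδ, hKl, hf0, hf, hT, hxl, hθl⟩ := exists_closing_shot hm hlam
  have hl := hT.s_pos
  have hδ := hd.trans_le hdδ
  have hK : 0 ≤ K := by linarith
  have h := isShot_of_profileField hd hdδ hKl hf0 hf
  have sym0 := fun s => reflect_eq_self hd hK hf (a := 0) (b := 0) cos_zero sin_zero
    (by simp [hf0]) (by simp [hf0]) s
  have syml := fun s => reflect_eq_self hd hK hf (a := l) (b := 2 * π) cos_two_pi sin_two_pi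
    hxl (by rw [hθl]) s
  simp only [mul_zero, zero_sub] at sym0
  let x : ℝ → ℝ := fun t => (f t).1
  let r : ℝ → ℝ := fun t => (f t).2.1
  let θ : ℝ → ℝ := fun t => (f t).2.2
  have xneg : ∀ s, x (-s) = -x s := fun s => (sym0 s).1
  have rneg : ∀ s, r (-s) = r s := fun s => (sym0 s).2.1
  have xrefl : ∀ s, x (2 * l - s) = -x s := fun s => (syml s).1
  have rrefl : ∀ s, r (2 * l - s) = r s := fun s => (syml s).2.1
  have xper : Function.Periodic x (2 * l) := fun s => by
    have := xrefl (s + 2 * l)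
    rw [show 2 * l - (s + 2 * l) = -s by ring, xneg] at this
    linarith
  have rper : Function.Periodic r (2 * l) := fun s => by
    have := rrefl (s + 2 * l)
    rw [show 2 * l - (s + 2 * l) = -s by ring, rneg] at this
    linarith
  -- By symmetry and periodicity the bounds on `[0, l]` hold for all times. The truncation is
  -- therefore never active, and the genuine equation is satisfied.
  have fold : ∀ s, ∃ t ∈ Icc 0 l, |x s| = |x t| ∧ r s = r t := by
    intro s
    have hper : Function.Periodic (fun s => (x s, r s)) (2 * l) := fun s => by
      simp only [xper s, rper s]
    obtain ⟨y, hy, hxy⟩ := hper.exists_mem_Ico (by linarith) s (-l)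
    simp only [Prod.mk.injEq] at hxy
    rcases le_total 0 y with h0 | h0
    · exact ⟨y, ⟨h0, by linarith [hy.2]⟩, by rw [hxy.1], hxy.2⟩
    · exact ⟨-y, ⟨by linarith, by linarith [hy.1]⟩, by rw [hxy.1, xneg, abs_neg], by rw [hxy.2, rneg]⟩
  have hrδ : ∀ s, δ ≤ r s := by
    intro s
    obtain ⟨t, ht, -, h2⟩ := fold s
    rw [h2]
    exact h.δ_le_r hT le_rfl ht
  have hrpos : ∀ s, 0 < r s := fun s => hδ.trans_le (hrδ s)
  have hbd : ∀ s, |x s| ≤ K ∧ |r s| ≤ K := by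
    intro s
    obtain ⟨t, ht, h1, h2⟩ := fold s
    rw [h1, h2]
    exact profileField_solution_bounds hδ hKl hf0 hf ht
  have hsol : IsProfileSolution m lam x r θ := by
    refine ⟨fun s => (hasDerivAt_components (hf s)).1, fun s => (hasDerivAt_components (hf s)).2.1,
      fun s => (hasDerivAt_components (hf s)).2.2.congr_deriv ?_⟩
    rw [profileField_angle_eq (hbd s).1 (hbd s).2, profileCurv, max_eq_left (hdδ.trans (hrδ s))]
  have hrmono : StrictMonoOn r (Icc 0 l) := h.r_strictMonoOn hT le_rfl
  have hxpos : ∀ t ∈ Ioo 0 l, 0 < x t := fun t ht => h.x_pos hT le_rfl hxl.ge ht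
  have dx : ∀ s, deriv x s = cos (θ s) := fun s => (hsol.hasDerivAt_x s).deriv
  have dr : ∀ s, deriv r s = sin (θ s) := fun s => (hsol.hasDerivAt_r s).deriv
  have hθ0 : θ 0 = 0 := by simp [θ, hf0]
  have hθl : θ l = π := hθl
  refine ⟨x, r, θ, l, ?_, hsol⟩
  refine
    { pos_length := hl
      smooth_x := (hsol.contDiff hrpos).1
      smooth_r := (hsol.contDiff hrpos).2.1
      arc_length := fun s => by rw [dx, dr, cos_sq_add_sin_sq]
      upper_half_plane := hrpos
      periodic_x := xper
      periodic_r := rper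
      simple := ?_
      reflect_x := xneg
      reflect_r := rneg
      start_on_axis := by simp [x, hf0]
      end_on_axis := hxl
      first_quadrant := hxpos
      start_below_end := hrmono ⟨le_rfl, hl.le⟩ ⟨hl.le, le_rfl⟩ hl
      start_horizontal := by simp [dx, dr, hθ0]
      end_horizontal := by simp [dx, dr, hθl] }
  -- Equal heights on the two halves force the points to be mirror images; since `x` is nonzero
  -- inside an arc, they cannot coincide.
  have mixed : ∀ s t, s ∈ Icc 0 l → t ∈ Ioo l (2 * l) → x s = x t → r s = r t → False := by
    intro s t hs ht hx hr
    have ht' : 2 * l - t ∈ Ioo 0 l := ⟨by linarith [ht.2], by linarith [ht.1]⟩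
    rw [← rrefl t] at hr
    have hst := hrmono.injOn hs (Ioo_subset_Icc_self ht') hr
    have h1 := hxpos _ ht'
    have h2 := xrefl t
    rw [← hst] at h1 h2
    linarith
  intro s hs t ht hst
  simp only [Prod.mk.injEq] at hst
  obtain ⟨hx, hr⟩ := hst
  rcases le_or_gt s l with hsl | hsl <;> rcases le_or_gt t l with htl | htl
  · exact hrmono.injOn ⟨hs.1, hsl⟩ ⟨ht.1, htl⟩ hr
  · exact (mixed s t ⟨hs.1, hsl⟩ ⟨htl, ht.2⟩ hx hr).elim
  · exact (mixed t s ⟨ht.1, htl⟩ ⟨hsl, hs.2⟩ hx.symm hr.symm).elim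
  · rw [← rrefl s, ← rrefl t] at hr
    have := hrmono.injOn ⟨by linarith [hs.2], by linarith⟩ ⟨by linarith [ht.2], by linarith⟩ hr
    linarith

end Profile

/-! ### Local smooth angles on the circle. -/

section CircleAngle

open Real

theorem contMDiff_coe_circle : ContMDiff (𝓡 1) 𝓘(ℝ, ℂ) ∞ (fun z : Circle => (z : ℂ)) :=
  haveI := finrank_real_complex_fact'
  contMDiff_coe_sphere (E := ℂ) (n := 1)

theorem injective_mvfderiv_coe_circle (z : Circle) :
    Function.Injective (mvfderiv (𝓡 1) (fun z : Circle => (z : ℂ)) z) :=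
  haveI := finrank_real_complex_fact'
  injective_mvfderiv_subtypeVal_sphere (E := ℂ) (n := 1) z

/-- Rotating by `z₀⁻¹` before taking the argument moves the branch cut away from `z₀`, while `a`
remains a section of `Circle.exp` everywhere. -/
theorem exists_angle (z₀ : Circle) : ∃ a : Circle → ℝ,
    ContMDiffAt (𝓡 1) 𝓘(ℝ, ℝ) ∞ a z₀ ∧ ∀ z, Circle.exp (a z) = z := by
  let g : ℂ → ℝ := fun w => Complex.arg z₀ + Complex.arg (w * (z₀⁻¹ : Circle))
  have hg : ContDiffAt ℝ ∞ g z₀ := by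
    have h1 : ContDiffAt ℝ ∞ (fun w : ℂ => w * (z₀⁻¹ : Circle)) z₀ := by fun_prop
    have h2 : ((z₀ : ℂ) * (z₀⁻¹ : Circle)) = 1 := by
      rw [← Circle.coe_mul, mul_inv_cancel, Circle.coe_one]
    have h3 : ContDiffAt ℝ ∞ (fun w : ℂ => Complex.log (w * (z₀⁻¹ : Circle))) z₀ :=
      ((Complex.contDiffAt_log (by rw [h2]; exact Complex.one_mem_slitPlane)).restrict_scalars
        ℝ).comp (z₀ : ℂ) h1
    have h4 := (Complex.imCLM.contDiff.contDiffAt (n := ∞)).comp (z₀ : ℂ) h3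
    exact contDiffAt_const.add
      (h4.congr_of_eventuallyEq (.of_forall fun w => (Complex.log_im _).symm))
  refine ⟨fun z => g z, hg.comp_contMDiffAt (f := (fun z : Circle => (z : ℂ))) (contMDiff_coe_circle z₀),
    fun z => ?_⟩
  simp only [g, ← Circle.coe_mul, Circle.exp_add, Circle.exp_arg]
  rw [mul_comm z, mul_inv_cancel_left]

/-- The inclusion of the circle in `ℂ` factors through `a` and has injective differential, so `a`
has too. -/
theorem injective_mvfderiv_angle {a : Circle → ℝ} {z : Circle}
    (ha : ContMDiffAt (𝓡 1) 𝓘(ℝ, ℝ) ∞ a z) (hexp : ∀ z, Circle.exp (a z) = z) :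
    Function.Injective (mvfderiv (𝓡 1) a z) := by
  have h1 : (fun z : Circle => (z : ℂ)) = (fun t : ℝ => Complex.exp (t * Complex.I)) ∘ a := by
    funext w
    rw [Function.comp_apply, ← Circle.coe_exp, hexp w]
  have h2 : HasFDerivAt (fun t : ℝ => Complex.exp (t * Complex.I))
      (fderiv ℝ (fun t : ℝ => Complex.exp (t * Complex.I)) (a z)) (a z) := by
    refine DifferentiableAt.hasFDerivAt ?_
    fun_prop
  have h3 := h2.hasMFDerivAt.comp z (ha.mdifferentiableAt (by simp)).hasMFDerivAt
  have h4 := injective_mvfderiv_coe_circle z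
  rw [mvfderiv, h1, h3.mfderiv] at h4
  intro u v huv
  refine h4 ?_
  exact congrArg (fderiv ℝ (fun t : ℝ => Complex.exp (t * Complex.I)) (a z)) huv

end CircleAngle

/-! ### Linear algebra of rotation about an axis. -/

section Revolve

open Real

variable {n : ℕ}

/-- The unit vector along the axis of revolution. -/
noncomputable def axisVec (n : ℕ) : EuclideanSpace ℝ (Fin (n + 1)) :=
  WithLp.toLp 2 (Fin.cons 1 0)

/-- The embedding of the hyperplane orthogonal to the axis of revolution. -/
noncomputable def orthEmb (n : ℕ) : EuclideanSpace ℝ (Fin n) →L[ℝ] EuclideanSpace ℝ (Fin (n + 1)) :=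
  LinearMap.toContinuousLinearMap
    { toFun := fun v => WithLp.toLp 2 (Fin.cons 0 v)
      map_add' := fun v w => by
        ext i; refine Fin.cases ?_ (fun i => ?_) i <;> simp
      map_smul' := fun c v => by
        ext i; refine Fin.cases ?_ (fun i => ?_) i <;> simp }

theorem inner_axisVec : ⟪axisVec n, axisVec n⟫_ℝ = 1 := by
  rw [PiLp.inner_apply]
  simp [axisVec, Fin.sum_univ_succ]

theorem inner_axisVec_orthEmb (v : EuclideanSpace ℝ (Fin n)) : ⟪axisVec n, orthEmb n v⟫_ℝ = 0 := by
  simp [axisVec, orthEmb, PiLp.inner_apply, Fin.sum_univ_succ]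

theorem inner_orthEmb_axisVec (v : EuclideanSpace ℝ (Fin n)) : ⟪orthEmb n v, axisVec n⟫_ℝ = 0 := by
  rw [real_inner_comm, inner_axisVec_orthEmb]

theorem inner_orthEmb (v w : EuclideanSpace ℝ (Fin n)) : ⟪orthEmb n v, orthEmb n w⟫_ℝ = ⟪v, w⟫_ℝ := by
  simp [orthEmb, PiLp.inner_apply, Fin.sum_univ_succ]

theorem orthEmb_eq_zero {v : EuclideanSpace ℝ (Fin n)} (h : orthEmb n v = 0) : v = 0 := by
  rw [← inner_self_eq_zero (𝕜 := ℝ), ← inner_orthEmb, h, inner_zero_left]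

theorem revolve_eq (a ρ : ℝ) (α : UnitSphere n) :
    revolve a ρ α = a • axisVec n + ρ • orthEmb n α := by
  ext i
  refine Fin.cases ?_ (fun i => ?_) i <;> simp [revolve, axisVec, orthEmb]

theorem inner_unitSphere (α : UnitSphere n) :
    ⟪(α : EuclideanSpace ℝ (Fin n)), (α : EuclideanSpace ℝ (Fin n))⟫_ℝ = 1 := by
  rw [real_inner_self_eq_norm_sq, norm_eq_of_mem_sphere, one_pow]

theorem inner_revolve (a ρ b σ : ℝ) (α : UnitSphere n) :
    ⟪revolve a ρ α, revolve b σ α⟫_ℝ = a * b + ρ * σ := by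
  simp only [revolve_eq, inner_add_left, inner_add_right, real_inner_smul_left,
    real_inner_smul_right, inner_axisVec, inner_axisVec_orthEmb, inner_orthEmb_axisVec,
    inner_orthEmb, inner_unitSphere]
  ring

theorem revolve_inj {a b ρ σ : ℝ} {α β : UnitSphere n} (hρ : 0 < ρ) (hσ : 0 < σ)
    (h : revolve a ρ α = revolve b σ β) : a = b ∧ ρ = σ ∧ α = β := by
  have h0 : a = b := by simpa [revolve] using congrArg (fun v => v.ofLp 0) h
  have h1 : ρ • (α : EuclideanSpace ℝ (Fin n)) = σ • (β : EuclideanSpace ℝ (Fin n)) := by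
    ext i
    simpa [revolve] using congrArg (fun v => v.ofLp i.succ) h
  have h2 : ρ = σ := by
    have := congrArg norm h1
    rwa [norm_smul, norm_smul, norm_eq_of_mem_sphere, norm_eq_of_mem_sphere, mul_one, mul_one,
      Real.norm_of_nonneg hρ.le, Real.norm_of_nonneg hσ.le] at this
  subst h2
  exact ⟨h0, rfl, Subtype.ext (smul_right_injective _ hρ.ne' h1)⟩

end Revolve

/-! ### Periodic functions as functions on the circle. -/

section PeriodicCircle

open Real

/-- The function on the circle induced by a `2 * l`-periodic function. -/
noncomputable def onCircle (g : ℝ → ℝ) (l : ℝ) (z : Circle) : ℝ := g (l / π * Complex.arg z)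

theorem onCircle_exp {g : ℝ → ℝ} {l : ℝ} (hg : Function.Periodic g (2 * l)) (t : ℝ) :
    onCircle g l (Circle.exp t) = g (l / π * t) := by
  obtain ⟨k, hk⟩ := Circle.exp_eq_exp.1 (Circle.exp_arg (Circle.exp t))
  rw [onCircle, hk]
  have e : l / π * (t + k * (2 * π)) = l / π * t + k * (2 * l) := by
    field_simp
  rw [e]
  exact hg.int_mul k _

/-- Periodicity allows `Complex.arg` to be replaced by any section of `Circle.exp`, in particular by
one smooth at the point considered. -/
theorem onCircle_eq {g : ℝ → ℝ} {l : ℝ} (hg : Function.Periodic g (2 * l)) {a : Circle → ℝ}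
    (ha : ∀ z, Circle.exp (a z) = z) (z : Circle) : onCircle g l z = g (l / π * a z) := by
  conv_lhs => rw [← ha z]
  exact onCircle_exp hg _

end PeriodicCircle

/-! ### Smoothness and differential of a rotated closed curve. -/

section Torus

open Real

variable {n : ℕ} [Fact (Module.finrank ℝ (EuclideanSpace ℝ (Fin n)) = n - 1 + 1)]

/-- The map `(z, α) ↦ (f z, g z • α)` on the product of the circle with the sphere, induced by
`2 * l`-periodic functions `f` and `g`. -/
noncomputable def revolveCurve (n : ℕ) (f g : ℝ → ℝ) (l : ℝ) (p : Circle × UnitSphere n) :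
    EuclideanSpace ℝ (Fin (n + 1)) :=
  revolve (onCircle f l p.1) (onCircle g l p.1) p.2

omit [Fact (Module.finrank ℝ (EuclideanSpace ℝ (Fin n)) = n - 1 + 1)] in
theorem revolveCurve_eq {f g : ℝ → ℝ} {l : ℝ} (hf : Function.Periodic f (2 * l))
    (hg : Function.Periodic g (2 * l)) {a : Circle → ℝ} (ha : ∀ z, Circle.exp (a z) = z) :
    revolveCurve n f g l = (fun q : ℝ × EuclideanSpace ℝ (Fin n) =>
      f (l / π * q.1) • axisVec n + g (l / π * q.1) • orthEmb n q.2) ∘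
        fun p : Circle × UnitSphere n => (a p.1, (p.2 : EuclideanSpace ℝ (Fin n))) := by
  funext p
  simp only [revolveCurve, Function.comp_apply, revolve_eq, onCircle_eq hf ha, onCircle_eq hg ha]

theorem contMDiff_revolveCurve {f g : ℝ → ℝ} {l : ℝ} (hf : Function.Periodic f (2 * l))
    (hg : Function.Periodic g (2 * l)) (hf' : ContDiff ℝ ∞ f) (hg' : ContDiff ℝ ∞ g) :
    ContMDiff ((𝓡 1).prod (𝓡 (n - 1))) 𝓘(ℝ, EuclideanSpace ℝ (Fin (n + 1))) ∞
      (revolveCurve n f g l) := by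
  intro p
  obtain ⟨a, ha, hexp⟩ := exists_angle p.1
  rw [revolveCurve_eq hf hg hexp]
  have h1 : ContMDiffAt ((𝓡 1).prod (𝓡 (n - 1))) 𝓘(ℝ, ℝ × EuclideanSpace ℝ (Fin n)) ∞
      (fun p : Circle × UnitSphere n => (a p.1, (p.2 : EuclideanSpace ℝ (Fin n)))) p :=
    (ha.comp p contMDiffAt_fst).prodMk_space
      ((contMDiff_coe_sphere p.2).comp p contMDiffAt_snd)
  refine ContDiff.comp_contMDiffAt ?_ h1
  fun_prop

/-- The immersion and its normal are both of the form `revolveCurve`, so this one formula provides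
both differentials for the shape operator. -/
theorem mvfderiv_revolveCurve_apply {f g : ℝ → ℝ} {l : ℝ} (hf : Function.Periodic f (2 * l))
    (hg : Function.Periodic g (2 * l)) {a : Circle → ℝ} (hexp : ∀ z, Circle.exp (a z) = z)
    {p : Circle × UnitSphere n} (ha : ContMDiffAt (𝓡 1) 𝓘(ℝ, ℝ) ∞ a p.1) {f' g' : ℝ}
    (hf' : HasDerivAt f f' (l / π * a p.1)) (hg' : HasDerivAt g g' (l / π * a p.1))
    (u : TangentSpace (𝓡 1) p.1) (w : TangentSpace (𝓡 (n - 1)) p.2) :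
    mvfderiv ((𝓡 1).prod (𝓡 (n - 1))) (revolveCurve n f g l) p (u, w) =
      (l / π * mvfderiv (𝓡 1) a p.1 u) • (f' • axisVec n + g' • orthEmb n p.2) +
        g (l / π * a p.1) •
          orthEmb n (mvfderiv (𝓡 (n - 1)) ((↑) : UnitSphere n → EuclideanSpace ℝ (Fin n)) p.2 w) := by
  have h1 : HasMFDerivAt ((𝓡 1).prod (𝓡 (n - 1))) 𝓘(ℝ, ℝ)
      (fun p : Circle × UnitSphere n => a p.1) p
      ((mvfderiv (𝓡 1) a p.1).comp
        (ContinuousLinearMap.fst ℝ (TangentSpace (𝓡 1) p.1) (TangentSpace (𝓡 (n - 1)) p.2))) :=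
    (ha.mdifferentiableAt (by simp)).hasMFDerivAt.comp p (hasMFDerivAt_fst p)
  have h2 : HasMFDerivAt ((𝓡 1).prod (𝓡 (n - 1))) 𝓘(ℝ, EuclideanSpace ℝ (Fin n))
      (fun p : Circle × UnitSphere n => (p.2 : EuclideanSpace ℝ (Fin n))) p
      ((mvfderiv (𝓡 (n - 1)) ((↑) : UnitSphere n → EuclideanSpace ℝ (Fin n)) p.2).comp
        (ContinuousLinearMap.snd ℝ (TangentSpace (𝓡 1) p.1) (TangentSpace (𝓡 (n - 1)) p.2))) :=
    ((contMDiff_coe_sphere (m := ∞) p.2).mdifferentiableAt (by simp)).hasMFDerivAt.comp p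
      (hasMFDerivAt_snd p)
  have h3 : ∀ {k : ℝ → ℝ} {k' : ℝ}, HasDerivAt k k' (l / π * a p.1) →
      HasMFDerivAt ((𝓡 1).prod (𝓡 (n - 1))) 𝓘(ℝ, ℝ)
        (fun p : Circle × UnitSphere n => k (l / π * a p.1)) p
        ((k' • (l / π) • ContinuousLinearMap.id ℝ ℝ).comp ((mvfderiv (𝓡 1) a p.1).comp
          (ContinuousLinearMap.fst ℝ (TangentSpace (𝓡 1) p.1) (TangentSpace (𝓡 (n - 1)) p.2)))) := by
    intro k k' hk
    have h4 : HasFDerivAt (fun t : ℝ => l / π * t) ((l / π) • ContinuousLinearMap.id ℝ ℝ) (a p.1) :=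
      (hasFDerivAt_id (a p.1)).const_mul (l / π)
    have h5 : HasFDerivAt (fun t : ℝ => k (l / π * t))
        (k' • (l / π) • ContinuousLinearMap.id ℝ ℝ) (a p.1) := hk.comp_hasFDerivAt_of_eq _ h4 rfl
    exact HasMFDerivAt.comp (f := fun p : Circle × UnitSphere n => a p.1) p h5.hasMFDerivAt h1
  have h5 := (orthEmb n).hasFDerivAt.hasMFDerivAt.comp p h2
  let F : Circle × UnitSphere n → ℝ := fun p => f (l / π * a p.1)
  let G : Circle × UnitSphere n → ℝ := fun p => g (l / π * a p.1)
  let J : Circle × UnitSphere n → EuclideanSpace ℝ (Fin (n + 1)) := orthEmb n ∘ fun p => p.2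
  have e : revolveCurve n f g l = F • (fun _ => axisVec n) + G • J := revolveCurve_eq hf hg hexp
  have d1 := (h3 hf').mdifferentiableAt
  have d2 := (h3 hg').mdifferentiableAt
  have d3 := h5.mdifferentiableAt
  have d0 : MDifferentiableAt ((𝓡 1).prod (𝓡 (n - 1))) 𝓘(ℝ, EuclideanSpace ℝ (Fin (n + 1)))
      (fun _ : Circle × UnitSphere n => axisVec n) p := mdifferentiableAt_const
  have m1 : mvfderiv ((𝓡 1).prod (𝓡 (n - 1))) F p (u, w) =
      f' * (l / π * mvfderiv (𝓡 1) a p.1 u) := congrArg (fun L => L (u, w)) (h3 hf').mfderiv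
  have m2 : mvfderiv ((𝓡 1).prod (𝓡 (n - 1))) G p (u, w) =
      g' * (l / π * mvfderiv (𝓡 1) a p.1 u) := congrArg (fun L => L (u, w)) (h3 hg').mfderiv
  have m3 : mvfderiv ((𝓡 1).prod (𝓡 (n - 1))) J p (u, w) =
      orthEmb n (mvfderiv (𝓡 (n - 1)) ((↑) : UnitSphere n → EuclideanSpace ℝ (Fin n)) p.2 w) :=
    congrArg (fun L => L (u, w)) h5.mfderiv
  have key : mvfderiv ((𝓡 1).prod (𝓡 (n - 1))) (revolveCurve n f g l) p =
      (mvfderiv ((𝓡 1).prod (𝓡 (n - 1))) F p).smulRight (axisVec n) +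
        (G p • mvfderiv ((𝓡 1).prod (𝓡 (n - 1))) J p +
          (mvfderiv ((𝓡 1).prod (𝓡 (n - 1))) G p).smulRight (J p)) := by
    rw [e, mvfderiv_add (d1.smul d0) (d2.smul d3), mvfderiv_smul d1 d0, mvfderiv_smul d2 d3,
      mvfderiv_const, smul_zero, zero_add]
  refine (congrArg (fun L => L (u, w)) key).trans ?_
  change mvfderiv ((𝓡 1).prod (𝓡 (n - 1))) F p (u, w) • axisVec n +
    (G p • mvfderiv ((𝓡 1).prod (𝓡 (n - 1))) J p (u, w) +
      mvfderiv ((𝓡 1).prod (𝓡 (n - 1))) G p (u, w) • J p) = _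
  rw [m1, m2, m3]
  simp only [G, J, Function.comp_apply]
  module

end Torus

/-! ### Embeddedness and mean curvature of the torus. -/

section TorusHypersurface

open Real

theorem IsTorusProfile.periodic_cos {m : ℕ} {x r θ : ℝ → ℝ} {l lam : ℝ} (h : IsTorusProfile x r l)
    (hsol : IsProfileSolution m lam x r θ) : Function.Periodic (fun s => cos (θ s)) (2 * l) := by
  intro s
  have : deriv x (s + 2 * l) = deriv x s := by
    rw [← deriv_comp_add_const, show (fun s => x (s + 2 * l)) = x from funext h.periodic_x]
  rwa [(hsol.hasDerivAt_x _).deriv, (hsol.hasDerivAt_x _).deriv] at this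

theorem IsTorusProfile.periodic_neg_sin {m : ℕ} {x r θ : ℝ → ℝ} {l lam : ℝ}
    (h : IsTorusProfile x r l) (hsol : IsProfileSolution m lam x r θ) :
    Function.Periodic (fun s => -sin (θ s)) (2 * l) := by
  intro s
  have : deriv r (s + 2 * l) = deriv r s := by
    rw [← deriv_comp_add_const, show (fun s => r (s + 2 * l)) = r from funext h.periodic_r]
  rw [(hsol.hasDerivAt_r _).deriv, (hsol.hasDerivAt_r _).deriv] at this
  simp only [this]

variable {n : ℕ} [Fact (Module.finrank ℝ (EuclideanSpace ℝ (Fin n)) = n - 1 + 1)]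

theorem inner_mvfderiv_coe_sphere (α : UnitSphere n) (w : TangentSpace (𝓡 (n - 1)) α) :
    ⟪mvfderiv (𝓡 (n - 1)) ((↑) : UnitSphere n → EuclideanSpace ℝ (Fin n)) α w,
      (α : EuclideanSpace ℝ (Fin n))⟫_ℝ = 0 := by
  have h : mvfderiv (𝓡 (n - 1)) ((↑) : UnitSphere n → EuclideanSpace ℝ (Fin n)) α w ∈
      (Submodule.span ℝ {(α : EuclideanSpace ℝ (Fin n))})ᗮ := by
    rw [← range_mvfderiv_subtypeVal (n := n - 1) α]
    exact ⟨w, rfl⟩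
  rw [real_inner_comm]
  exact Submodule.mem_orthogonal_singleton_iff_inner_right.1 h

/-- The source is compact, so a continuous injection suffices. As `r > 0`, the image point
determines `x`, `r` and the point of the sphere, and simplicity of the profile then determines the
parameter. -/
theorem isEmbedding_revolveCurve {x r : ℝ → ℝ} {l : ℝ} (h : IsTorusProfile x r l) :
    Topology.IsEmbedding (revolveCurve n x r l) := by
  have hl := h.pos_length
  refine ((contMDiff_revolveCurve h.periodic_x h.periodic_r h.smooth_x
    h.smooth_r).continuous.isClosedEmbedding ?_).isEmbedding
  have hrep : ∀ z : Circle, ∃ s ∈ Set.Ico 0 (2 * l), Circle.exp (π / l * s) = z := by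
    intro z
    have hper : Function.Periodic (fun s => Circle.exp (π / l * s)) (2 * l) := fun s => by
      simp only [mul_add]
      rw [show π / l * (2 * l) = 2 * π by field_simp, Circle.exp_add_two_pi]
    obtain ⟨s, hs, hs'⟩ := hper.exists_mem_Ico₀ (by linarith) (l / π * Complex.arg z)
    refine ⟨s, hs, ?_⟩
    rw [← hs', show π / l * (l / π * Complex.arg z) = Complex.arg z by field_simp, Circle.exp_arg]
  have hval : ∀ {g : ℝ → ℝ}, Function.Periodic g (2 * l) → ∀ s,
      onCircle g l (Circle.exp (π / l * s)) = g s := fun hg s => by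
    rw [onCircle_exp hg, show l / π * (π / l * s) = s by field_simp]
  rintro ⟨z, α⟩ ⟨z', β⟩ hzz
  obtain ⟨s, hs, rfl⟩ := hrep z
  obtain ⟨t, ht, rfl⟩ := hrep z'
  simp only [revolveCurve, hval h.periodic_x, hval h.periodic_r] at hzz
  obtain ⟨h1, h2, h3⟩ := revolve_inj (h.upper_half_plane s) (h.upper_half_plane t) hzz
  have : s = t := h.simple hs ht (by simp only [h1, h2])
  rw [this, h3]

theorem trace_smul_prodMap_smul (k₁ k₂ : ℕ) (a b : ℝ) :
    LinearMap.trace ℝ (EuclideanSpace ℝ (Fin k₁) × EuclideanSpace ℝ (Fin k₂))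
      (LinearMap.prodMap (a • LinearMap.id) (b • LinearMap.id)) = a * k₁ + b * k₂ := by
  rw [LinearMap.trace_prodMap']
  simp

theorem isLambdaHypersurface_revolveCurve {x r θ : ℝ → ℝ} {l lam : ℝ} (hn : 2 ≤ n)
    (h : IsTorusProfile x r l) (hsol : IsProfileSolution (n - 1) lam x r θ) :
    IsLambdaHypersurface ((𝓡 1).prod (𝓡 (n - 1))) (revolveCurve n x r l)
      (revolveCurve n (fun s => -sin (θ s)) (fun s => cos (θ s)) l) lam := by
  have hl := h.pos_length
  have pcos := h.periodic_cos hsol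
  have psin := h.periodic_neg_sin hsol
  have hθ := (hsol.contDiff h.upper_half_plane).2.2
  have hXsm := contMDiff_revolveCurve (n := n) h.periodic_x h.periodic_r h.smooth_x h.smooth_r
  have hNsm := contMDiff_revolveCurve (n := n) psin pcos hθ.sin.neg hθ.cos
  -- One parameter `s` and injective maps `c`, `j`, common to all pairs of periodic functions, so
  -- that the differentials of the immersion and the normal can be compared directly.
  have diff : ∀ p : Circle × UnitSphere n, ∃ (s : ℝ) (c : EuclideanSpace ℝ (Fin 1) →ₗ[ℝ] ℝ)
      (j : EuclideanSpace ℝ (Fin (n - 1)) →ₗ[ℝ] EuclideanSpace ℝ (Fin n)),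
      Function.Injective c ∧ Function.Injective j ∧
      (∀ w, ⟪j w, (p.2 : EuclideanSpace ℝ (Fin n))⟫_ℝ = 0) ∧
      (∀ {g : ℝ → ℝ}, Function.Periodic g (2 * l) → onCircle g l p.1 = g s) ∧
      ∀ {f g : ℝ → ℝ} {f' g' : ℝ}, Function.Periodic f (2 * l) → Function.Periodic g (2 * l) →
        HasDerivAt f f' s → HasDerivAt g g' s → ∀ u w,
          mvfderiv ((𝓡 1).prod (𝓡 (n - 1))) (revolveCurve n f g l) p (u, w) =
            c u • (f' • axisVec n + g' • orthEmb n p.2) + g s • orthEmb n (j w) := by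
    intro p
    obtain ⟨a, ha, hexp⟩ := exists_angle p.1
    refine ⟨l / π * a p.1, ((l / π) • mvfderiv (𝓡 1) a p.1).toLinearMap,
      (mvfderiv (𝓡 (n - 1)) ((↑) : UnitSphere n → EuclideanSpace ℝ (Fin n)) p.2).toLinearMap,
      fun u v huv => ?_, injective_mvfderiv_subtypeVal_sphere (n := n - 1) p.2,
      inner_mvfderiv_coe_sphere p.2, fun hg => onCircle_eq hg hexp _,
      fun hf hg hf' hg' u w => mvfderiv_revolveCurve_apply hf hg hexp ha hf' hg' u w⟩
    refine injective_mvfderiv_angle ha hexp ?_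
    have : l / π * mvfderiv (𝓡 1) a p.1 u = l / π * mvfderiv (𝓡 1) a p.1 v := huv
    exact mul_left_cancel₀ (by positivity) this
  refine ⟨⟨?_, hXsm, fun p => ?_, hNsm, fun p => ?_, fun p v => ?_⟩, fun p => ?_⟩
  · rw [Module.finrank_prod, finrank_euclideanSpace_fin, finrank_euclideanSpace_fin]
    omega
  · obtain ⟨s, c, j, hc, hj, hjα, -, hd⟩ := diff p
    rw [injective_iff_map_eq_zero]
    rintro ⟨u, w⟩ huw
    have hX := (hd h.periodic_x h.periodic_r (hsol.hasDerivAt_x s) (hsol.hasDerivAt_r s) u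
      w).symm.trans huw
    -- Pairing with the unit tangent of the meridian isolates the circle component.
    have h1 := congrArg (fun y => ⟪y, cos (θ s) • axisVec n + sin (θ s) • orthEmb n p.2⟫_ℝ) hX
    simp only [inner_zero_left, inner_add_left, inner_add_right, real_inner_smul_left,
      real_inner_smul_right, inner_axisVec, inner_axisVec_orthEmb, inner_orthEmb_axisVec,
      inner_orthEmb, inner_unitSphere, hjα] at h1
    have hcu : c u = 0 := by
      have : c u * (cos (θ s) ^ 2 + sin (θ s) ^ 2) = 0 := by linarith
      rwa [cos_sq_add_sin_sq, mul_one] at this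
    rw [hcu, zero_smul, zero_add] at hX
    have hw := orthEmb_eq_zero ((smul_eq_zero.1 hX).resolve_left (h.upper_half_plane s).ne')
    have hu' : u = 0 := hc (hcu.trans c.map_zero.symm)
    have hw' : w = 0 := hj (hw.trans j.map_zero.symm)
    rw [hu', hw']
    rfl
  · obtain ⟨s, -, -, -, -, -, hv, -⟩ := diff p
    have : ‖revolveCurve n (fun s => -sin (θ s)) (fun s => cos (θ s)) l p‖ ^ 2 = 1 := by
      rw [← real_inner_self_eq_norm_sq, revolveCurve, inner_revolve, hv psin, hv pcos]
      nlinarith [sin_sq_add_cos_sq (θ s)]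
    exact (pow_eq_one_iff_of_nonneg (norm_nonneg _) two_ne_zero).1 this
  · obtain ⟨s, c, j, -, -, hjα, hv, hd⟩ := diff p
    obtain ⟨u, w⟩ := v
    have hX := hd h.periodic_x h.periodic_r (hsol.hasDerivAt_x s) (hsol.hasDerivAt_r s) u w
    refine (congrArg (fun y => ⟪y, _⟫_ℝ) hX).trans ?_
    rw [revolveCurve, revolve_eq, hv psin, hv pcos]
    simp only [inner_add_left, inner_add_right, real_inner_smul_left,
      real_inner_smul_right, inner_axisVec, inner_axisVec_orthEmb, inner_orthEmb_axisVec,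
      inner_orthEmb, inner_unitSphere, hjα]
    ring
  · obtain ⟨s, c, j, -, -, -, hv, hd⟩ := diff p
    have hr := (h.upper_half_plane s).ne'
    obtain ⟨κ, hκ⟩ : ∃ κ, κ =
        lam + x s * sin (θ s) + (((n - 1 : ℕ) : ℝ) / r s - r s) * cos (θ s) := ⟨_, rfl⟩
    have hθs : HasDerivAt θ κ s := hκ ▸ hsol.hasDerivAt_θ s
    -- Meridian and parallels are principal directions, with curvatures `κ = θ'` and `-cos θ / r`.
    -- In the trace, the term `(n - 1) cos θ / r` of `κ` cancels, leaving `lam` minus the support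
    -- function.
    let A : EuclideanSpace ℝ (Fin 1) × EuclideanSpace ℝ (Fin (n - 1)) →ₗ[ℝ]
        EuclideanSpace ℝ (Fin 1) × EuclideanSpace ℝ (Fin (n - 1)) :=
      LinearMap.prodMap (κ • LinearMap.id) ((-(cos (θ s) / r s)) • LinearMap.id)
    refine ⟨κ * (1 : ℕ) + -(cos (θ s) / r s) * (n - 1 : ℕ), ⟨A, ?_, trace_smul_prodMap_smul _ _ _ _⟩,
      ?_⟩
    · rintro ⟨u, w⟩
      have hN := hd psin pcos hθs.sin.neg hθs.cos u w
      have hX := hd h.periodic_x h.periodic_r (hsol.hasDerivAt_x s) (hsol.hasDerivAt_r s)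
        (κ • u) ((-(cos (θ s) / r s)) • w)
      refine hN.trans (Eq.trans ?_ (congrArg Neg.neg hX.symm))
      rw [c.map_smul, j.map_smul, map_smul, smul_smul, smul_eq_mul,
        show r s * -(cos (θ s) / r s) = -cos (θ s) by field_simp]
      module
    · rw [revolveCurve, revolveCurve, inner_revolve, hv h.periodic_x, hv h.periodic_r, hv psin,
        hv pcos, hκ]
      field_simp
      push_cast
      ring

end TorusHypersurface

theorem theorem1p1 (n : ℕ) (hn : 2 ≤ n) (lam : ℝ) (hlam : 0 < lam) :
    haveI := fact_finrank_euclideanSpace hn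
    ∃ X N : Circle × UnitSphere n → EuclideanSpace ℝ (Fin (n + 1)),
      Topology.IsEmbedding X ∧
      IsLambdaHypersurface ((𝓡 1).prod (𝓡 (n - 1))) X N lam ∧
      ∃ (x r : ℝ → ℝ) (l : ℝ), IsTorusProfile x r l ∧
        ∀ (s : ℝ) (α : UnitSphere n),
          X (Circle.exp (Real.pi * s / l), α) = revolve (x s) (r s) α ∧
          N (Circle.exp (Real.pi * s / l), α) = revolve (-deriv r s) (deriv x s) α := by
  have := fact_finrank_euclideanSpace hn
  obtain ⟨x, r, θ, l, h, hsol⟩ := exists_torusProfile (m := n - 1) (by omega) hlam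
  have hl := h.pos_length
  have hval : ∀ {g : ℝ → ℝ}, Function.Periodic g (2 * l) → ∀ s,
      onCircle g l (Circle.exp (Real.pi * s / l)) = g s := fun hg s => by
    rw [onCircle_exp hg, show l / Real.pi * (Real.pi * s / l) = s by field_simp]
  refine ⟨_, _, isEmbedding_revolveCurve h, isLambdaHypersurface_revolveCurve hn h hsol, x, r, l, h,
    fun s α => ⟨?_, ?_⟩⟩
  · simp only [revolveCurve, hval h.periodic_x, hval h.periodic_r]
  · rw [(hsol.hasDerivAt_r s).deriv, (hsol.hasDerivAt_x s).deriv]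
    simp only [revolveCurve, hval (h.periodic_neg_sin hsol), hval (h.periodic_cos hsol)]
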